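/- **Setting.** $\mathbf{HA}^\omega$ is Heyting arithmetic in all finite types over the ground types $\mathbb N$ and $\mathbb B$ (Booleans). Its formulas are built with $\bot,\wedge,\to,\forall x^\sigma,\exists x^\sigma$ from the logical equalities $\equiv_\sigma$, one for each finite type $\sigma$. Its constants are the combinators $\Pi,\Sigma$, $\mathsf 0^{\mathbb N}$, $\mathsf S^{\mathbb N\to\mathbb N}$, the recursors $\mathsf R_\sigma$ of type $\mathbb N\to\sigma\to(\mathbb N\to\sigma\to\sigma)\to\sigma$, the Booleans $0,1$, and $\mathrm{Cond}_\sigma$ of type $\mathbb B\to\sigma\to\sigma\to\sigma$. Its axioms are: $\forall x\,(x\equiv x)$; $\forall x,y\,(A\wedge x\equiv y\to A')$ for quantifier-free $A$, with $A'$ obtained by replacing occurrences of $x$ by $y$; the equations for $\Pi,\Sigma,\mathrm{Cond}_\sigma,\mathsf R_\sigma$; $\neg(0\equiv_{\mathbb B}1)$; $D(0)\wedge D(1)\to\forall i^{\mathbb B}D(i)$; injectivity of $\mathsf S$; $\neg(\mathsf Sx\equiv\mathsf 0)$; and induction for all formulas. The target theory is the set of truths of the full set-theoretic structure $\mathcal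 S^\omega_*$, where $\mathcal S_{\mathbb N}=\mathbb N$, $\mathcal S_{\mathbb B}=\{0,1\}$, $\mathcal S_{\sigma\to\tau}$ is the set of all functions from $\mathcal S_\sigma$ to $\mathcal S_\tau$, and $\mathcal S_{\sigma^*}$ is the set of non-empty finite subsets of $\mathcal S_\sigma$. The *arithmetical star types* are generated from $\mathbb N$ by $\to$ and $(\cdot)^*$. The *closed witnessing terms* are the closed terms of arithmetical star type built by application from $\Pi,\Sigma$, the star constants $x\mapsto\{x\}$, $\cup$, $(F,f)\mapsto\bigcup_{w\in F}fw$, $\mathsf 0$, $\mathsf S$, the recursors, and the maximum $\mathrm m:\mathbb N^*\to\mathbb N$. Bezem's relation on these types is: $x\le^B_{\mathbb N}y$ iff $x\le y$; $f\le^B_{\sigma\to\tau}g$ iff for all $x\le^B_\sigma y$ both $fx\le^B_\tau gy$ and $gx\le^B_\tau gy$; $a\le^B_{\sigma^*}b$ iff $\forall u\in a\,\exists v\in b\,(u\le^B_\sigma v)$ and $\forall v\in b\,(v\le^B_\sigma v)$. An element $a$ is *monotone* if $a\le^B a$. For a finite type $\sigma$ over $\mathbb N,\mathbb B$, let $\sigma^\dagger$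 be an arithmetical type or empty: $\mathbb N^\dagger=\mathbb N$; $\mathbb B^\dagger$ is empty; $(\sigma\to\tau)^\dagger=\sigma^\dagger\to\tau^\dagger$ if both are non-empty, $(\sigma\to\tau)^\dagger=\tau^\dagger$ if $\sigma^\dagger$ is empty, and $(\sigma\to\tau)^\dagger$ is empty if $\tau^\dagger$ is empty. The type $\sigma$ is *bounded* if $\sigma^\dagger$ is empty, and *unbounded* otherwise. For unbounded $\sigma$, the relation $x\le^B_\sigma a$ between $x\in\mathcal S_\sigma$ and $a\in\mathcal S_{\sigma^\dagger}$ is: $x\le a$ if $\sigma=\mathbb N$; for $\sigma,\tau$ unbounded, $f\le^B_{\sigma\to\tau}g$ iff $\forall x,a\,(x\le^B_\sigma a\to fx\le^B_\tau ga)$ and $\forall z,a\,(z\le^B_{\sigma^\dagger}a\to gz\le^B_{\tau^\dagger}ga)$; for $\sigma$ bounded and $\tau$ unbounded, $f\le^B_{\sigma\to\tau}c$ iff $\forall x\,(fx\le^B_\tau c)$ and $c\le^B_{\tau^\dagger}c$. **The interpretation $\mathcal I^{\mathrm{mb}}$.** Extend the language by unary predicates $\mathcal I_\sigma$, one for each finite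 type $\sigma$. Each formula $A$ of the extended language is given a relation $|A|^{\vec a}_{\vec b}$ between the values of its free variables, a tuple $\vec a$ of positive witnesses and a tuple $\vec b$ of negative witnesses of fixed arithmetical star types (possibly empty tuples). Write $\vec b\in\vec B$ for componentwise membership. * $|x\equiv y|$ is $x=y$ and $|\bot|$ is $\bot$, both with empty tuples. * $|\mathcal I_\sigma(x)|^{a}$ is $x\le^B_\sigma a$, with $a:\sigma^\dagger$ and no negative witness, if $\sigma$ is unbounded; $|\mathcal I_\sigma(x)|$ is true, with empty tuples, if $\sigma$ is bounded. * $|A\wedge B|^{\vec a,\vec c}_{\vec b,\vec d}$ is $|A|^{\vec a}_{\vec b}\wedge|B|^{\vec c}_{\vec d}$. * $|A\to B|^{\vec f,\vec g}_{\vec a,\vec d}$ is $\forall\vec b\in\vec g\vec a\vec d\,|A|^{\vec a}_{\vec b}\to|B|^{\vec f\vec a}_{\vec d}$. * $|\forall x^\sigma A|^{\vec a}_{\vec b}$ is $\forall x^\sigma|A|^{\vec a}_{\vec b}$. * $|\exists x^\sigma A|^{\vec a}_{\vec B}$ is $\exists x^\sigma\,\forall\vec b\in\vec B\,|A|^{\vec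 a}_{\vec b}$. The witnessing elements are the monotone elements. A formula $A$ is *$\mathcal U$-interpretable* if there are closed witnessing terms $\vec t$ denoting monotone elements such that $|A|^{\vec t}_{\vec b}$ holds in $\mathcal S^\omega_*$ for all tuples $\vec b$ of monotone elements and all values of the free variables. A formula $A(x_1,\dots,x_n)$ of $\mathbf{HA}^\omega$ is *$\mathcal I$-interpretable* if $\forall\vec x\,(\mathcal I(x_1)\wedge\dots\wedge\mathcal I(x_n)\to A^{\mathcal I}(\vec x))$ is $\mathcal U$-interpretable, where $A^{\mathcal I}$ relativizes every quantifier $\forall x^\sigma,\exists x^\sigma$ of $A$ to $\mathcal I_\sigma$. **Theorem.** The $\mathcal I^{\mathrm{mb}}$-interpretation is a sound type-informative base interpretation of $\mathbf{HA}^\omega$. That is: 1. The monotone elements of the arithmetical star types are closed under application; they include the combinators, the star constants, $\mathsf 0$, $\mathsf S$ and $\mathrm m$; and the monotone elements of type $\rho^*$ are the non-empty finite sets of monotone elements of type $\rho$. 2. The sentence $\mathcal I_\sigma(c)$ is $\mathcal U$-interpretable for every constant $c^\sigma$ of $\mathbf{HA}^\omega$ (including $\mathrm{Cond}_\sigma$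 and $\mathsf R_\sigma$), and the sentence $\forall x^\sigma\forall f^{\sigma\to\tau}(\mathcal I_\sigma(x)\wedge\mathcal I_{\sigma\to\tau}(f)\to\mathcal I_\tau(fx))$ is $\mathcal U$-interpretable for all finite types $\sigma,\tau$. 3. Every axiom of $\mathbf{HA}^\omega$ listed above is $\mathcal I$-interpretable. -/

import Mathlib

namespace FunInt

/-! ### Tuples -/

/-- Tuples `(x₁, …, xₙ)` with `xᵢ : D aᵢ`, for a list `[a₁, …, aₙ]` of sorts. -/
def Tuple {α : Type} (D : α → Type) : List α → Type
  | [] => Unit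
  | a :: l => D a × Tuple D l

namespace Tuple

variable {α : Type} {D E : α → Type}

/-- The first part of a concatenated tuple. -/
def left : {l m : List α} → Tuple D (l ++ m) → Tuple D l
  | [], _, _ => ()
  | _ :: _, _, p => (p.1, left p.2)

/-- The second part of a concatenated tuple. -/
def right : {l m : List α} → Tuple D (l ++ m) → Tuple D m
  | [], _, p => p
  | _ :: l, _, p => right (l := l) p.2

/-- Apply a family of maps to all components. -/
def map (f : ∀ a, D a → E a) : {l : List α} → Tuple D l → Tuple E l
  | [], _ => ()
  | _ :: _, p => (f _ p.1, map f p.2)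

/-- Every component satisfies `P`. -/
def All (P : ∀ a, D a → Prop) : {l : List α} → Tuple D l → Prop
  | [], _ => True
  | _ :: _, p => P _ p.1 ∧ All P p.2

end Tuple

/-! ### Source types, source terms and their set-theoretic meaning -/

/-- The finite types over the ground types `ℕ` and `𝔹`. -/
inductive Ty : Type
  | nat : Ty
  | bool : Ty
  | arr : Ty → Ty → Ty

infixr:60 " ⇒ " => Ty.arr

/-- The full set-theoretic type structure on the source types, with `S_𝔹 = {0, 1}`. -/
@[reducible] def Ty.Interp : Ty → Type
  | .nat => ℕ
  | .bool => Fin 2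
  | .arr σ τ => σ.Interp → τ.Interp

/-- Variables of type `σ` in a context (a list of types), as de Bruijn indices. -/
inductive Var : List Ty → Ty → Type
  | zero {Γ : List Ty} {σ : Ty} : Var (σ :: Γ) σ
  | succ {Γ : List Ty} {σ τ : Ty} : Var Γ σ → Var (τ :: Γ) σ

/-- The constants of the language of `HA^ω`: combinators, zero, successor, recursors, the two
Booleans `0` and `1`, and the conditionals. -/
inductive Const : Ty → Type
  | pi (ρ σ : Ty) : Const (ρ ⇒ σ ⇒ ρ)
  | sig (ρ σ γ : Ty) : Const ((γ ⇒ σ ⇒ ρ) ⇒ (γ ⇒ σ) ⇒ γ ⇒ ρ)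
  | zero : Const .nat
  | succ : Const (.nat ⇒ .nat)
  | recur (σ : Ty) : Const (.nat ⇒ σ ⇒ (.nat ⇒ σ ⇒ σ) ⇒ σ)
  | bool0 : Const .bool
  | bool1 : Const .bool
  | cond (σ : Ty) : Const (.bool ⇒ σ ⇒ σ ⇒ σ)

/-- Source terms in a context. -/
inductive Tm (Γ : List Ty) : Ty → Type
  | var {σ : Ty} : Var Γ σ → Tm Γ σ
  | const {σ : Ty} : Const σ → Tm Γ σ
  | app {σ τ : Ty} : Tm Γ (σ ⇒ τ) → Tm Γ σ → Tm Γ τ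

/-- Assignments of set-theoretic elements to the variables of a context. -/
abbrev Env (Γ : List Ty) : Type := Tuple Ty.Interp Γ

def Var.eval : {Γ : List Ty} → {σ : Ty} → Var Γ σ → Env Γ → σ.Interp
  | _, _, .zero, e => e.1
  | _, _, .succ v, e => v.eval e.2

def Const.eval : {σ : Ty} → Const σ → σ.Interp
  | _, .pi _ _ => fun x _ => x
  | _, .sig _ _ _ => fun x y z => x z (y z)
  | _, .zero => (0 : ℕ)
  | _, .succ => fun n : ℕ => n + 1
  | _, .recur _ => fun (n : ℕ) w f => Nat.rec w (fun k r => f k r) n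
  | _, .bool0 => (0 : Fin 2)
  | _, .bool1 => (1 : Fin 2)
  | _, .cond _ => fun (i : Fin 2) x y => if i = 0 then x else y

def Tm.eval {Γ : List Ty} : {σ : Ty} → Tm Γ σ → Env Γ → σ.Interp
  | _, .var v, e => v.eval e
  | _, .const c, _ => c.eval
  | _, .app t s, e => (t.eval e) (s.eval e)

/-- Simultaneous renaming of variables. -/
def Tm.rename {Γ Δ : List Ty} (r : ∀ σ, Var Γ σ → Var Δ σ) : {σ : Ty} → Tm Γ σ → Tm Δ σ
  | _, .var v => .var (r _ v)
  | _, .const c => .const c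
  | _, .app t s => .app (t.rename r) (s.rename r)

/-- Simultaneous substitution of terms for variables. -/
def Tm.subst {Γ Δ : List Ty} (s : ∀ σ, Var Γ σ → Tm Δ σ) : {σ : Ty} → Tm Γ σ → Tm Δ σ
  | _, .var v => s _ v
  | _, .const c => .const c
  | _, .app t u => .app (t.subst s) (u.subst s)

/-- A substitution under a binder. -/
def liftSubst {Γ Δ : List Ty} {τ : Ty} (s : ∀ σ, Var Γ σ → Tm Δ σ) :
    ∀ σ, Var (τ :: Γ) σ → Tm (τ :: Δ) σ
  | _, .zero => .var .zero
  | _, .succ v => (s _ v).rename (fun _ w => .succ w)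

/-! ### Source formulas -/

/-- Formulas of the language of `HA^ω` with free variables in the context `Γ`. The only relation
symbols are the logical equalities; negation is `A → ⊥`. -/
inductive Form : List Ty → Type
  | eq {Γ : List Ty} {σ : Ty} : Tm Γ σ → Tm Γ σ → Form Γ
  | bot {Γ : List Ty} : Form Γ
  | and {Γ : List Ty} : Form Γ → Form Γ → Form Γ
  | imp {Γ : List Ty} : Form Γ → Form Γ → Form Γ
  | all {Γ : List Ty} (σ : Ty) : Form (σ :: Γ) → Form Γ
  | ex {Γ : List Ty} (σ : Ty) : Form (σ :: Γ) → Form Γ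

def Form.QuantifierFree : {Γ : List Ty} → Form Γ → Prop
  | _, .eq _ _ => True
  | _, .bot => True
  | _, .and A B => A.QuantifierFree ∧ B.QuantifierFree
  | _, .imp A B => A.QuantifierFree ∧ B.QuantifierFree
  | _, .all _ _ => False
  | _, .ex _ _ => False

/-- Simultaneous substitution in formulas. -/
def Form.subst : {Γ Δ : List Ty} → (∀ σ, Var Γ σ → Tm Δ σ) → Form Γ → Form Δ
  | _, _, s, .eq t u => .eq (t.subst s) (u.subst s)
  | _, _, _, .bot => .bot
  | _, _, s, .and A B => .and (A.subst s) (B.subst s)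
  | _, _, s, .imp A B => .imp (A.subst s) (B.subst s)
  | _, _, s, .all σ A => .all σ (A.subst (liftSubst s))
  | _, _, s, .ex σ A => .ex σ (A.subst (liftSubst s))

/-- The substitution of `t` for the variable `0`, the other variables being unchanged. -/
def instSubst {Γ : List Ty} {τ : Ty} (t : Tm Γ τ) : ∀ σ, Var (τ :: Γ) σ → Tm Γ σ
  | _, .zero => t
  | _, .succ v => .var v

/-- `A[t]`, the instance of `A(x)` at the term `t`. -/
def Form.inst {Γ : List Ty} {τ : Ty} (A : Form (τ :: Γ)) (t : Tm Γ τ) : Form Γ :=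
  A.subst (instSubst t)

/-- The substitution of `S x` for the variable `x` with index `0`. -/
def succSubst {Γ : List Ty} : ∀ σ, Var (.nat :: Γ) σ → Tm (.nat :: Γ) σ
  | _, .zero => .app (.const .succ) (.var .zero)
  | _, .succ v => .var (.succ v)

/-- The non-logical axioms of `HA^ω` (with the axioms for equality and for the combinators). They
are formulas with parameters in an arbitrary context where they are schemes. In a context
`[σ₀, σ₁, …]` the variable `Var.zero` has type `σ₀`, the variable `Var.succ Var.zero` has type `σ₁`,
and so on. -/
inductive Ax : {Γ : List Ty} → Form Γ → Prop
  /-- `∀ x (x ≡ x)` -/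
  | eq_refl (σ : Ty) : Ax (Γ := []) (.all σ (.eq (.var .zero) (.var .zero)))
  /-- `∀ x y (A ∧ x ≡ y → A')`, with `A` quantifier-free and `A'` obtained from `A` by replacing
  some occurrences of `x` by `y`. Here `C` has an extra variable `z` (of index `0`) which marks
  the occurrences that are replaced; `A` is `C[x/z]` and `A'` is `C[y/z]`. -/
  | eq_subst {Γ : List Ty} (σ : Ty) (C : Form (σ :: σ :: σ :: Γ)) (hC : C.QuantifierFree) :
      Ax (.all σ (.all σ (.imp
        (.and (C.inst (.var (.succ .zero))) (.eq (.var (.succ .zero)) (.var .zero)))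
        (C.inst (.var .zero)))))
  /-- `Π x y ≡ x` -/
  | pi (ρ σ : Ty) : Ax (Γ := [ρ, σ])
      (.eq (.app (.app (.const (.pi ρ σ)) (.var .zero)) (.var (.succ .zero))) (.var .zero))
  /-- `Σ x y z ≡ x z (y z)` -/
  | sig (ρ σ γ : Ty) : Ax (Γ := [γ ⇒ σ ⇒ ρ, γ ⇒ σ, γ])
      (.eq
        (.app (.app (.app (.const (.sig ρ σ γ)) (.var .zero)) (.var (.succ .zero)))
          (.var (.succ (.succ .zero))))
        (.app (.app (.var .zero) (.var (.succ (.succ .zero))))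
          (.app (.var (.succ .zero)) (.var (.succ (.succ .zero))))))
  /-- `¬ (0 ≡ 1)` for the Booleans -/
  | bool_ne : Ax (Γ := []) (.imp (.eq (.const .bool0) (.const .bool1)) .bot)
  /-- `D(0) ∧ D(1) → ∀ i D(i)` for the Booleans -/
  | bool_elim {Γ : List Ty} (D : Form (.bool :: Γ)) :
      Ax (.imp (.and (D.inst (.const .bool0)) (D.inst (.const .bool1))) (.all .bool D))
  /-- `Cond(0, x, y) ≡ x` -/
  | cond_zero (σ : Ty) : Ax (Γ := [σ, σ])
      (.eq (.app (.app (.app (.const (.cond σ)) (.const .bool0)) (.var .zero))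
        (.var (.succ .zero))) (.var .zero))
  /-- `Cond(1, x, y) ≡ y` -/
  | cond_one (σ : Ty) : Ax (Γ := [σ, σ])
      (.eq (.app (.app (.app (.const (.cond σ)) (.const .bool1)) (.var .zero))
        (.var (.succ .zero))) (.var (.succ .zero)))
  /-- `S x ≡ S y → x ≡ y` -/
  | succ_inj : Ax (Γ := [.nat, .nat])
      (.imp (.eq (.app (.const .succ) (.var .zero)) (.app (.const .succ) (.var (.succ .zero))))
        (.eq (.var .zero) (.var (.succ .zero))))
  /-- `¬ (S x ≡ 0)` -/
  | succ_ne_zero : Ax (Γ := [.nat])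
      (.imp (.eq (.app (.const .succ) (.var .zero)) (.const .zero)) .bot)
  /-- `R 0 w f ≡ w` -/
  | recur_zero (σ : Ty) : Ax (Γ := [σ, .nat ⇒ σ ⇒ σ])
      (.eq (.app (.app (.app (.const (.recur σ)) (.const .zero)) (.var .zero))
        (.var (.succ .zero))) (.var .zero))
  /-- `R (S n) w f ≡ f n (R n w f)` -/
  | recur_succ (σ : Ty) : Ax (Γ := [.nat, σ, .nat ⇒ σ ⇒ σ])
      (.eq
        (.app (.app (.app (.const (.recur σ)) (.app (.const .succ) (.var .zero)))
          (.var (.succ .zero))) (.var (.succ (.succ .zero))))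
        (.app (.app (.var (.succ (.succ .zero))) (.var .zero))
          (.app (.app (.app (.const (.recur σ)) (.var .zero)) (.var (.succ .zero)))
            (.var (.succ (.succ .zero))))))
  /-- `A(0) ∧ ∀ x (A(x) → A(S x)) → ∀ x A(x)` -/
  | induction {Γ : List Ty} (A : Form (.nat :: Γ)) :
      Ax (.imp (.and (A.inst (.const .zero)) (.all .nat (.imp A (A.subst succSubst))))
        (.all .nat A))

/-! ### The extended language, with the type-informative predicates -/

/-- Formulas of the language of `HA^ω` extended with a unary predicate `I_σ` for each type `σ`;
`info t` is `I_σ(t)`. -/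
inductive IForm : List Ty → Type
  | eq {Γ : List Ty} {σ : Ty} : Tm Γ σ → Tm Γ σ → IForm Γ
  | info {Γ : List Ty} {σ : Ty} : Tm Γ σ → IForm Γ
  | bot {Γ : List Ty} : IForm Γ
  | and {Γ : List Ty} : IForm Γ → IForm Γ → IForm Γ
  | imp {Γ : List Ty} : IForm Γ → IForm Γ → IForm Γ
  | all {Γ : List Ty} (σ : Ty) : IForm (σ :: Γ) → IForm Γ
  | ex {Γ : List Ty} (σ : Ty) : IForm (σ :: Γ) → IForm Γ

/-- Relativization of the quantifiers to the type-informative predicates. -/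
def Form.relativize : {Γ : List Ty} → Form Γ → IForm Γ
  | _, .eq t u => .eq t u
  | _, .bot => .bot
  | _, .and A B => .and A.relativize B.relativize
  | _, .imp A B => .imp A.relativize B.relativize
  | _, .all σ A => .all σ (.imp (.info (.var .zero)) A.relativize)
  | _, .ex σ A => .ex σ (.and (.info (.var .zero)) A.relativize)

/-- The list of all variables of a context. -/
def allVars : (Γ : List Ty) → List (Σ σ : Ty, Var Γ σ)
  | [] => []
  | σ :: Γ => ⟨σ, .zero⟩ :: (allVars Γ).map (fun v => ⟨v.1, .succ v.2⟩)

/-- The conjunction `I(v) ∧ I(w₁) ∧ … ∧ I(wₖ)` of a non-empty list of variables. -/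
def infoConj {Γ : List Ty} : (Σ σ : Ty, Var Γ σ) → List (Σ σ : Ty, Var Γ σ) → IForm Γ
  | v, [] => .info (.var v.2)
  | v, w :: l => .and (.info (.var v.2)) (infoConj w l)

/-- `I(x₁) ∧ … ∧ I(xₙ) → A` (just `A` if there are no variables). -/
def infoImp {Γ : List Ty} (A : IForm Γ) : List (Σ σ : Ty, Var Γ σ) → IForm Γ
  | [] => A
  | v :: l => .imp (infoConj v l) A

/-- Universal closure. -/
def IForm.close : {Γ : List Ty} → IForm Γ → IForm []
  | [], A => A
  | σ :: _, A => IForm.close (.all σ A)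

/-- The sentence `∀ x₁ … xₙ (I(x₁) ∧ … ∧ I(xₙ) → A^I)` for a formula `A(x₁, …, xₙ)`. -/
def Form.guardedClosure {Γ : List Ty} (A : Form Γ) : IForm [] :=
  (infoImp A.relativize (allVars Γ)).close

/-! ### Witnessing types and witnessing terms -/

/-- The arithmetical star types. -/
inductive WTy : Type
  | nat : WTy
  | arr : WTy → WTy → WTy
  | star : WTy → WTy

infixr:60 " ⇾ " => WTy.arr

/-- The full set-theoretic star type structure: `star ρ` is the type of the non-empty finite
subsets of `ρ`. -/
@[reducible] def WTy.Interp : WTy → Type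
  | .nat => ℕ
  | .arr ρ τ => ρ.Interp → τ.Interp
  | .star ρ => {F : Set ρ.Interp // F.Nonempty ∧ F.Finite}

/-- The constants of the witnessing language: the combinators, the star constants, zero, successor,
the recursors, and the maximum of a non-empty finite set of numbers. -/
inductive WConst : WTy → Type
  | pi (ρ σ : WTy) : WConst (ρ ⇾ σ ⇾ ρ)
  | sig (ρ σ γ : WTy) : WConst ((γ ⇾ σ ⇾ ρ) ⇾ (γ ⇾ σ) ⇾ γ ⇾ ρ)
  | sing (σ : WTy) : WConst (σ ⇾ .star σ)
  | union (σ : WTy) : WConst (.star σ ⇾ .star σ ⇾ .star σ)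
  | bigUnion (σ τ : WTy) : WConst (.star σ ⇾ (σ ⇾ .star τ) ⇾ .star τ)
  | zero : WConst .nat
  | succ : WConst (.nat ⇾ .nat)
  | recur (σ : WTy) : WConst (.nat ⇾ σ ⇾ (.nat ⇾ σ ⇾ σ) ⇾ σ)
  | max : WConst (.star .nat ⇾ .nat)

/-- Closed witnessing terms. -/
inductive WTm : WTy → Type
  | const {ρ : WTy} : WConst ρ → WTm ρ
  | app {ρ τ : WTy} : WTm (ρ ⇾ τ) → WTm ρ → WTm τ

noncomputable def WConst.eval : {ρ : WTy} → WConst ρ → ρ.Interp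
  | _, .pi _ _ => fun x _ => x
  | _, .sig _ _ _ => fun x y z => x z (y z)
  | _, .sing _ => fun x => ⟨{x}, Set.singleton_nonempty x, Set.finite_singleton x⟩
  | _, .union _ => fun F G => ⟨F.1 ∪ G.1, F.2.1.inl, F.2.2.union G.2.2⟩
  | _, .bigUnion _ _ => fun F f => ⟨⋃ w ∈ F.1, (f w).1,
      F.2.1.elim fun w hw => (f w).2.1.elim fun v hv => ⟨v, Set.mem_biUnion hw hv⟩,
      F.2.2.biUnion fun w _ => (f w).2.2⟩
  | _, .zero => (0 : ℕ)
  | _, .succ => fun n : ℕ => n + 1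
  | _, .recur _ => fun (n : ℕ) w f => Nat.rec w (fun k r => f k r) n
  | _, .max => fun F => (sSup F.1 : ℕ)

noncomputable def WTm.eval : {ρ : WTy} → WTm ρ → ρ.Interp
  | _, .const c => c.eval
  | _, .app t s => t.eval s.eval

/-- Tuples of witnessing elements. -/
abbrev WTuple (l : List WTy) : Type := Tuple WTy.Interp l

/-- The type `ρ₁ → … → ρₙ → τ`. -/
def WTy.arrs : List WTy → WTy → WTy
  | [], τ => τ
  | ρ :: l, τ => ρ ⇾ WTy.arrs l τ

/-- `f a₁ … aₙ`. -/
def applyAll : {l : List WTy} → {τ : WTy} → (WTy.arrs l τ).Interp → WTuple l → τ.Interp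
  | [], _, f, _ => f
  | _ :: _, _, f, a => applyAll (f a.1) a.2

/-- Application of a tuple of functionals to a tuple of arguments: `(f₁ a, …, fₖ a)`. -/
def appTuple {l : List WTy} : {m : List WTy} → WTuple (m.map (WTy.arrs l)) → WTuple l → WTuple m
  | [], _, _ => ()
  | _ :: _, f, a => (applyAll f.1 a, appTuple f.2 a)

/-- `b ∈ B` for a tuple `B` of finite sets: `b₁ ∈ B₁, …, bₖ ∈ Bₖ`. -/
def memTuple : {m : List WTy} → WTuple m → WTuple (m.map WTy.star) → Prop
  | [], _, _ => True
  | _ :: _, b, B => b.1 ∈ B.1.1 ∧ memTuple b.2 B.2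

/-! ### Base interpretations and the `U`- and `I`-interpretations -/

/-- An information relation `|x|^a_b` for `x : X`, with the tuples of types of the positive
witnesses `a` and of the negative witnesses `b`. -/
structure InfoRel (X : Type) where
  pos : List WTy
  neg : List WTy
  rel : X → WTuple pos → WTuple neg → Prop

namespace InfoRel

variable {X Y : Type}

/-- A witness-free relation. -/
def witnessFree (P : X → Prop) : InfoRel X := ⟨[], [], fun x _ _ => P x⟩

/-- `|A|^a_b ∧ |B|^c_d` with positive witnesses `a, c` and negative witnesses `b, d`. -/
def and (A B : InfoRel X) : InfoRel X where
  pos := A.pos ++ B.pos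
  neg := A.neg ++ B.neg
  rel x p n := A.rel x p.left n.left ∧ B.rel x p.right n.right

/-- `∀ b ∈ g a d |A|^a_b → |B|^{f a}_d` with positive witnesses `f, g` and negative witnesses
`a, d`. -/
def imp (A B : InfoRel X) : InfoRel X where
  pos := B.pos.map (WTy.arrs A.pos) ++ (A.neg.map WTy.star).map (WTy.arrs (A.pos ++ B.neg))
  neg := A.pos ++ B.neg
  rel x fg ad :=
    (∀ b : WTuple A.neg, memTuple b (appTuple fg.right ad) → A.rel x ad.left b) →
      B.rel x (appTuple fg.left ad.left) ad.right

/-- `∀ x |A(x)|^a_b`. -/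
def all (A : InfoRel (Y × X)) : InfoRel X where
  pos := A.pos
  neg := A.neg
  rel x a b := ∀ y, A.rel (y, x) a b

/-- `∃ x ∀ b ∈ B |A(x)|^a_b`, with negative witnesses `B`. -/
def ex (A : InfoRel (Y × X)) : InfoRel X where
  pos := A.pos
  neg := A.neg.map WTy.star
  rel x a B := ∃ y, ∀ b : WTuple A.neg, memTuple b B → A.rel (y, x) a b

end InfoRel

/-- A base interpretation: which elements of the witnessing types are the witnessing elements, and
an information relation for each type-informative predicate `I_σ`. (Logical equality has a fixed
interpretation.) -/
structure BaseInterp where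
  elem : ∀ ρ : WTy, ρ.Interp → Prop
  info : ∀ σ : Ty, InfoRel σ.Interp

namespace BaseInterp

variable (I : BaseInterp)

/-- The `U`-interpretation of the formulas of the extended language. -/
def uInter : {Γ : List Ty} → IForm Γ → InfoRel (Env Γ)
  | _, .eq t u => .witnessFree fun e => t.eval e = u.eval e
  | _, .info (σ := σ) t => ⟨(I.info σ).pos, (I.info σ).neg, fun e => (I.info σ).rel (t.eval e)⟩
  | _, .bot => .witnessFree fun _ => False
  | _, .and A B => (uInter A).and (uInter B)
  | _, .imp A B => (uInter A).imp (uInter B)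
  | Γ, .all σ A => InfoRel.all (Y := σ.Interp) (X := Env Γ) (uInter A)
  | Γ, .ex σ A => InfoRel.ex (Y := σ.Interp) (X := Env Γ) (uInter A)

/-- `A` is `U`-interpretable in the set of truths of the set-theoretic structure: there are closed
witnessing terms `t`, denoting witnessing elements, such that `|A|^t_b` holds for all values of the
free variables and all tuples `b` of witnessing elements. -/
def UInterpretable {Γ : List Ty} (A : IForm Γ) : Prop :=
  ∃ t : Tuple WTm (I.uInter A).pos,
    (t.map fun _ s => s.eval : WTuple (I.uInter A).pos).All I.elem ∧
    ∀ (e : Env Γ) (b : WTuple (I.uInter A).neg), b.All I.elem →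
      (I.uInter A).rel e (t.map fun _ s => s.eval) b

/-- `A(x₁, …, xₙ)` is `I`-interpretable if `∀ x₁ … xₙ (I(x₁) ∧ … ∧ I(xₙ) → A^I)` is
`U`-interpretable. -/
def IInterpretable {Γ : List Ty} (A : Form Γ) : Prop :=
  I.UInterpretable A.guardedClosure

/-- The witnessing elements form an applicative structure with the witnessing constants other than
the recursors, and the witnessing elements of type `ρ*` are the non-empty finite sets of witnessing
elements of type `ρ`. -/
structure IsWitnessStructure : Prop where
  app : ∀ (ρ τ : WTy) (f : (ρ ⇾ τ).Interp) (x : ρ.Interp),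
    I.elem (ρ ⇾ τ) f → I.elem ρ x → I.elem τ (f x)
  star : ∀ (ρ : WTy) (F : (WTy.star ρ).Interp),
    I.elem (.star ρ) F ↔ ∀ x ∈ F.1, I.elem ρ x
  pi : ∀ ρ σ, I.elem _ (WConst.pi ρ σ).eval
  sig : ∀ ρ σ γ, I.elem _ (WConst.sig ρ σ γ).eval
  sing : ∀ σ, I.elem _ (WConst.sing σ).eval
  union : ∀ σ, I.elem _ (WConst.union σ).eval
  bigUnion : ∀ σ τ, I.elem _ (WConst.bigUnion σ τ).eval
  zero : I.elem _ WConst.zero.eval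
  succ : I.elem _ WConst.succ.eval
  max : I.elem _ WConst.max.eval

/-- The sentence `∀ x ∀ f (I_σ(x) ∧ I_{σ → τ}(f) → I_τ(f x))`. -/
def appSentence (σ τ : Ty) : IForm [] :=
  .all σ (.all (σ ⇒ τ) (.imp
    (.and (.info (.var (.succ .zero))) (.info (.var .zero)))
    (.info (.app (.var .zero) (.var (.succ .zero))))))

/-- Type-informative base interpretations: (i) the sentences `I_σ(c)`, for the constants `c`, and
(ii) the sentences `∀ x ∀ f (I_σ(x) ∧ I_{σ → τ}(f) → I_τ(f x))` are `U`-interpretable. -/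
structure IsTypeInformative : Prop where
  witness : I.IsWitnessStructure
  const : ∀ {σ : Ty} (c : Const σ), I.UInterpretable (Γ := []) (.info (.const c))
  app : ∀ σ τ : Ty, I.UInterpretable (appSentence σ τ)

/-- Sound type-informative base interpretations of `HA^ω`. -/
structure IsSoundTypeInformative : Prop where
  typeInformative : I.IsTypeInformative
  axioms : ∀ {Γ : List Ty} (A : Form Γ), Ax A → I.IInterpretable A

end BaseInterp

/-! ### Majorizability -/

/-- Bezem's strong majorizability relation `≤^B` on the arithmetical star types. -/
def WTy.Maj : (ρ : WTy) → ρ.Interp → ρ.Interp → Prop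
  | .nat, x, y => (x : ℕ) ≤ y
  | .arr ρ τ, f, g => ∀ x y, ρ.Maj x y → τ.Maj (f x) (g y) ∧ τ.Maj (g x) (g y)
  | .star ρ, a, b => (∀ u ∈ a.1, ∃ v ∈ b.1, ρ.Maj u v) ∧ ∀ v ∈ b.1, ρ.Maj v v

/-- Monotone elements. -/
def WTy.Monotone (ρ : WTy) (a : ρ.Interp) : Prop := ρ.Maj a a

/-- `σ† → τ†`, where `none` is the empty tuple of types. -/
def arrDagger : Option WTy → Option WTy → Option WTy
  | some s, some t => some (s ⇾ t)
  | none, some t => some t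
  | _, none => none

/-- `σ†`: an arithmetical type, or the empty tuple of types if `σ` is bounded. -/
def Ty.dagger : Ty → Option WTy
  | .nat => some .nat
  | .bool => none
  | .arr σ τ => arrDagger σ.dagger τ.dagger

/-- The relation at type `σ → τ`, given `s = σ†`, `t = τ†` and the relations `Q` at type `σ` and
`R` at type `τ`. -/
def arrMaj {X Y : Type} : (s t : Option WTy) → (X → WTuple s.toList → Prop) →
    (Y → WTuple t.toList → Prop) → (X → Y) → WTuple (arrDagger s t).toList → Prop
  | some s, some t, Q, R, f, (g, _) =>
      (∀ (x : X) (a : s.Interp), Q x (a, ()) → R (f x) ((g : s.Interp → t.Interp) a, ())) ∧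
        ∀ z a : s.Interp, s.Maj z a → t.Maj (g z) (g a)
  | none, some t, _, R, f, (c, _) => (∀ x : X, R (f x) (c, ())) ∧ t.Maj c c
  | some _, none, _, _, _, _ => True
  | none, none, _, _, _, _ => True

/-- The relation `x ≤^B_σ a` between `x : σ` and `a : σ†` for the unbounded types `σ`, and the
relation that is always true for the bounded types `σ`, where the tuple `a` is empty. -/
def Ty.Maj : (σ : Ty) → σ.Interp → WTuple σ.dagger.toList → Prop
  | .nat, x, a => (x : ℕ) ≤ a.1
  | .bool, _, _ => True
  | .arr σ τ, f, g => arrMaj σ.dagger τ.dagger σ.Maj τ.Maj f g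

/-- The majorizability upon the bounding interpretation: `I_σ(x)` is interpreted by `x ≤^B_σ a`
(with positive witness `a : σ†`) if `σ` is unbounded, and uniformly if `σ` is bounded. The
witnessing elements are the monotone elements of the arithmetical star types. -/
def Imb : BaseInterp where
  elem := WTy.Monotone
  info σ := ⟨σ.dagger.toList, [], fun x a _ => σ.Maj x a⟩

end FunInt

/-! A witness has to be a closed term and a monotone element at once. The recursors are terms, but
they are in general not monotone: the value after one step may lie below the initial value. The
proof therefore works with `Witnessing` functions, which are definable from closed terms and
preserve majorizability. They are closed under abstraction (`Witnessing.lam`), application, joins,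
finite unions, and recursion whose step is inflationary (`Witnessing.natRec`, and `Witnessings.iter`
for tuples). If every value is majorized by the next one, the result is monotone in the number of
steps as well.

The second ingredient is `upward_uInter`: `|A|^a_b` persists when the monotone `a` is enlarged
pointwise. Several candidate witnesses can thus be replaced by their join. The conditional and
Boolean elimination take the join of the two cases. The recursors and induction make their step
inflationary by joining it with the previous value.

For induction up to a bound `N`, the positive witnesses are `a₀ = a`, `aₖ₊₁ = aₖ ∨ f aₖ`, and `a_N`
serves all `k ≤ N`. The counterexamples travel in the opposite direction: proving `A(k+1)` at `d`
may require `A(k)` at all members of `g aₖ d`. Finite sets large enough for `N` such steps are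
collected in advance (`negSet`), and `rel_posIter` runs the induction.

The remaining axioms have no computational content: without quantifiers there are no witnesses, and
the interpretation is set-theoretic truth. Guards on parameters can be ignored, because the
witnesses found are uniform in the parameters. The constants are majorized by what remains after
their bounded arguments are erased. -/

namespace FunInt

/-! ### Concatenation and componentwise relations of tuples -/

namespace Tuple

variable {α : Type} {D : α → Type}

/-- Concatenation of tuples. -/
def append : {l m : List α} → Tuple D l → Tuple D m → Tuple D (l ++ m)
  | [], _, _, q => q
  | _ :: _, _, p, q => (p.1, append p.2 q)

@[simp] theorem left_append : ∀ {l m : List α} (p : Tuple D l) (q : Tuple D m),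
    (p.append q).left = p
  | [], _, _, _ => rfl
  | _ :: _, _, p, q => Prod.ext rfl (left_append p.2 q)

@[simp] theorem right_append : ∀ {l m : List α} (p : Tuple D l) (q : Tuple D m),
    (p.append q).right = q
  | [], _, _, _ => rfl
  | _ :: _, _, p, q => right_append p.2 q

/-- Two tuples are related componentwise. -/
def Rel (R : ∀ a, D a → D a → Prop) : {l : List α} → Tuple D l → Tuple D l → Prop
  | [], _, _ => True
  | _ :: _, p, q => R _ p.1 q.1 ∧ Rel R p.2 q.2

variable {P : ∀ a, D a → Prop} {R : ∀ a, D a → D a → Prop}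

theorem All.left : ∀ {l m : List α} {p : Tuple D (l ++ m)}, p.All P → p.left.All P
  | [], _, _, _ => trivial
  | _ :: l, _, _, h => ⟨h.1, All.left (l := l) h.2⟩

theorem All.right : ∀ {l m : List α} {p : Tuple D (l ++ m)}, p.All P → p.right.All P
  | [], _, _, h => h
  | _ :: l, _, _, h => All.right (l := l) h.2

theorem All.append : ∀ {l m : List α} {p : Tuple D l} {q : Tuple D m},
    p.All P → q.All P → (p.append q).All P
  | [], _, _, _, _, h => h
  | _ :: _, _, _, _, h, h' => ⟨h.1, All.append h.2 h'⟩

theorem Rel.left : ∀ {l m : List α} {p q : Tuple D (l ++ m)}, p.Rel R q → p.left.Rel R q.left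
  | [], _, _, _, _ => trivial
  | _ :: l, _, _, _, h => ⟨h.1, Rel.left (l := l) h.2⟩

theorem Rel.right : ∀ {l m : List α} {p q : Tuple D (l ++ m)}, p.Rel R q → p.right.Rel R q.right
  | [], _, _, _, h => h
  | _ :: l, _, _, _, h => Rel.right (l := l) h.2

theorem Rel.append : ∀ {l m : List α} {p p' : Tuple D l} {q q' : Tuple D m},
    p.Rel R p' → q.Rel R q' → (p.append q).Rel R (p'.append q')
  | [], _, _, _, _, _, _, h => h
  | _ :: _, _, _, _, _, _, h, h' => ⟨h.1, Rel.append h.2 h'⟩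

theorem Rel.trans (hR : ∀ a x y z, R a x y → R a y z → R a x z) :
    ∀ {l : List α} {p q r : Tuple D l}, p.Rel R q → q.Rel R r → p.Rel R r
  | [], _, _, _, _, _ => trivial
  | _ :: _, _, _, _, h, h' => ⟨hR _ _ _ _ h.1 h'.1, Rel.trans hR h.2 h'.2⟩

theorem Rel.refl (hR : ∀ a x, R a x x) : ∀ {l : List α} (p : Tuple D l), p.Rel R p
  | [], _ => trivial
  | _ :: _, p => ⟨hR _ _, Rel.refl hR p.2⟩

end Tuple

/-! ### Majorizability on the witnessing types -/

/-- This is what the second clauses of Bezem's relation, at function and star types, are for. -/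
theorem WTy.Maj.right : ∀ {ρ : WTy} {x y : ρ.Interp}, ρ.Maj x y → ρ.Maj y y
  | .nat, _, y, _ => Nat.le_refl y
  | .arr _ _, _, _, h => fun x y hxy => ⟨(h x y hxy).2, (h x y hxy).2⟩
  | .star _, _, _, h => ⟨fun u hu => ⟨u, hu, h.2 u hu⟩, h.2⟩

/-- At function types the chain is `f x ≤ g y ≤ h y`; its second link evaluates the second relation
at `y ≤ y`, supplied by `WTy.Maj.right`. -/
theorem WTy.Maj.trans : ∀ {ρ : WTy} {x y z : ρ.Interp}, ρ.Maj x y → ρ.Maj y z → ρ.Maj x z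
  | .nat, _, _, _, h, h' => Nat.le_trans h h'
  | .arr _ _, _, _, _, h, h' => fun x y hxy =>
      ⟨WTy.Maj.trans (h x y hxy).1 (h' y y hxy.right).1, (h' x y hxy).2⟩
  | .star _, _, _, _, h, h' => ⟨fun u hu => by
      obtain ⟨v, hv, huv⟩ := h.1 u hu
      obtain ⟨w, hw, hvw⟩ := h'.1 v hv
      exact ⟨w, hw, huv.trans hvw⟩, h'.2⟩

theorem WTy.monotone_arr_iff {ρ τ : WTy} {f : (ρ ⇾ τ).Interp} :
    (ρ ⇾ τ).Monotone f ↔ ∀ x y, ρ.Maj x y → τ.Maj (f x) (f y) :=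
  ⟨fun h x y hxy => (h x y hxy).1, fun h x y hxy => ⟨h x y hxy, h x y hxy⟩⟩

theorem WTy.Monotone.app {ρ τ : WTy} {f : (ρ ⇾ τ).Interp} {x : ρ.Interp}
    (hf : (ρ ⇾ τ).Monotone f) (hx : ρ.Monotone x) : τ.Monotone (f x) :=
  (hf x x hx).1

theorem WTy.monotone_star_iff {ρ : WTy} {F : (WTy.star ρ).Interp} :
    (WTy.star ρ).Monotone F ↔ ∀ x ∈ F.1, ρ.Monotone x :=
  ⟨fun h => h.2, fun h => ⟨fun u hu => ⟨u, hu, h u hu⟩, h⟩⟩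

/-- Componentwise majorizability of tuples. -/
def WTuple.Maj {l : List WTy} (p q : WTuple l) : Prop := Tuple.Rel (fun ρ => ρ.Maj) p q

/-- Tuples of monotone elements. -/
def WTuple.Mono {l : List WTy} (p : WTuple l) : Prop := Tuple.All WTy.Monotone p

theorem WTuple.Maj.trans {l : List WTy} {p q r : WTuple l} (h : WTuple.Maj p q)
    (h' : WTuple.Maj q r) : WTuple.Maj p r :=
  Tuple.Rel.trans (fun _ _ _ _ => WTy.Maj.trans) h h'

theorem WTuple.Mono.maj : ∀ {l : List WTy} {p : WTuple l}, WTuple.Mono p → WTuple.Maj p p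
  | [], _, _ => trivial
  | _ :: _, _, h => ⟨h.1, WTuple.Mono.maj h.2⟩

theorem WTuple.Maj.mono_right : ∀ {l : List WTy} {p q : WTuple l}, WTuple.Maj p q → WTuple.Mono q
  | [], _, _, _ => trivial
  | _ :: _, _, _, h => ⟨h.1.right, WTuple.Maj.mono_right h.2⟩

theorem WTuple.Maj.right {l : List WTy} {p q : WTuple l} (h : WTuple.Maj p q) : WTuple.Maj q q :=
  h.mono_right.maj

theorem WTuple.Mono.mem : ∀ {l : List WTy} {b : WTuple l} {B : WTuple (l.map WTy.star)},
    WTuple.Mono B → memTuple b B → WTuple.Mono b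
  | [], _, _, _, _ => trivial
  | _ :: _, _, _, h, hb => ⟨WTy.monotone_star_iff.1 h.1 _ hb.1, WTuple.Mono.mem h.2 hb.2⟩

/-! ### The pointwise order and joins -/

/-- The pointwise order, with inclusion at the star types. -/
def WTy.Le : (ρ : WTy) → ρ.Interp → ρ.Interp → Prop
  | .nat, x, y => (x : ℕ) ≤ y
  | .arr _ τ, f, g => ∀ x, τ.Le (f x) (g x)
  | .star _, a, b => a.1 ⊆ b.1

theorem WTy.Le.refl : ∀ {ρ : WTy} (x : ρ.Interp), ρ.Le x x
  | .nat, x => Nat.le_refl x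
  | .arr _ _, f => fun x => WTy.Le.refl (f x)
  | .star _, _ => fun _ h => h

theorem WTy.Le.trans : ∀ {ρ : WTy} {x y z : ρ.Interp}, ρ.Le x y → ρ.Le y z → ρ.Le x z
  | .nat, _, _, _, h, h' => Nat.le_trans h h'
  | .arr _ _, _, _, _, h, h' => fun x => WTy.Le.trans (h x) (h' x)
  | .star _, _, _, _, h, h' => fun _ hx => h' (h hx)

/-- At function types, `f x ≤ f y` by monotonicity of `f`, and `f y` lies below `g y` pointwise.
Unlike `WTy.Maj`, the pointwise order is reflexive on all elements, so order arguments are made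
there and transferred. -/
theorem WTy.Le.maj : ∀ {ρ : WTy} {x y : ρ.Interp}, ρ.Le x y → ρ.Monotone x → ρ.Monotone y →
    ρ.Maj x y
  | .nat, _, _, h, _, _ => h
  | .arr _ _, _, _, h, hf, hg => fun x y hxy =>
      ⟨(hf x y hxy).1.trans ((h y).maj (hf.app hxy.right) (hg.app hxy.right)), (hg x y hxy).1⟩
  | .star _, _, _, h, _, hb => ⟨fun u hu => ⟨u, h hu, hb.2 u (h hu)⟩, hb.2⟩

/-- An upper bound of two elements in the pointwise order. -/
noncomputable def WTy.join : (ρ : WTy) → ρ.Interp → ρ.Interp → ρ.Interp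
  -- The maximum is spelled out with witnessing constants so that joins are values of closed terms.
  | .nat, x, y => WConst.max.eval ((WConst.union .nat).eval ((WConst.sing .nat).eval x)
      ((WConst.sing .nat).eval y))
  | .arr _ τ, f, g => fun x => τ.join (f x) (g x)
  | .star ρ, a, b => (WConst.union ρ).eval a b

theorem WTy.le_join_left : ∀ {ρ : WTy} (x y : ρ.Interp), ρ.Le x (ρ.join x y)
  | .nat, x, y => le_csSup (α := ℕ) (((Set.finite_singleton x).union (Set.finite_singleton y)).bddAbove)
      (Or.inl rfl)
  | .arr _ _, f, g => fun x => WTy.le_join_left (f x) (g x)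
  | .star _, _, _ => fun _ h => Or.inl h

theorem WTy.le_join_right : ∀ {ρ : WTy} (x y : ρ.Interp), ρ.Le y (ρ.join x y)
  | .nat, x, y => le_csSup (α := ℕ) (((Set.finite_singleton x).union (Set.finite_singleton y)).bddAbove)
      (Or.inr rfl)
  | .arr _ _, f, g => fun x => WTy.le_join_right (f x) (g x)
  | .star _, _, _ => fun _ h => Or.inr h

/-- The pointwise order on tuples. -/
def WTuple.Le {l : List WTy} (p q : WTuple l) : Prop := Tuple.Rel (fun ρ => ρ.Le) p q

theorem WTuple.Le.trans {l : List WTy} {p q r : WTuple l} (h : WTuple.Le p q)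
    (h' : WTuple.Le q r) : WTuple.Le p r :=
  Tuple.Rel.trans (fun _ _ _ _ => WTy.Le.trans) h h'

theorem WTuple.Le.refl {l : List WTy} (p : WTuple l) : WTuple.Le p p :=
  Tuple.Rel.refl (fun _ => WTy.Le.refl) p

theorem WTuple.Le.maj : ∀ {l : List WTy} {p q : WTuple l}, WTuple.Le p q → WTuple.Mono p →
    WTuple.Mono q → WTuple.Maj p q
  | [], _, _, _, _, _ => trivial
  | _ :: _, _, _, h, hp, hq => ⟨h.1.maj hp.1 hq.1, WTuple.Le.maj h.2 hp.2 hq.2⟩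

/-- Componentwise joins. -/
noncomputable def WTuple.join : {l : List WTy} → WTuple l → WTuple l → WTuple l
  | [], _, _ => ()
  | ρ :: _, p, q => (ρ.join p.1 q.1, WTuple.join p.2 q.2)

theorem WTuple.le_join_left : ∀ {l : List WTy} (p q : WTuple l), WTuple.Le p (WTuple.join p q)
  | [], _, _ => trivial
  | _ :: _, p, q => ⟨WTy.le_join_left p.1 q.1, WTuple.le_join_left p.2 q.2⟩

theorem WTuple.le_join_right : ∀ {l : List WTy} (p q : WTuple l), WTuple.Le q (WTuple.join p q)
  | [], _, _ => trivial
  | _ :: _, p, q => ⟨WTy.le_join_right p.1 q.1, WTuple.le_join_right p.2 q.2⟩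

/-- Inclusion at the star types is essential here: under `WTy.Maj`, a member of `B` would only have
a majorant in `C`. -/
theorem memTuple_mono : ∀ {m : List WTy} {b : WTuple m} {B C : WTuple (m.map WTy.star)},
    WTuple.Le B C → memTuple b B → memTuple b C
  | [], _, _, _, _, _ => trivial
  | _ :: _, _, _, _, h, hb => ⟨h.1 hb.1, memTuple_mono h.2 hb.2⟩

/-! ### Monotonicity of the constants -/

theorem WConst.monotone_max : WTy.Monotone _ WConst.max.eval := by
  refine WTy.monotone_arr_iff.2 fun a b h => ?_
  refine csSup_le (α := ℕ) a.2.1 fun u hu => ?_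
  obtain ⟨v, hv, huv⟩ := h.1 u hu
  exact Nat.le_trans huv (le_csSup (α := ℕ) b.2.2.bddAbove hv)

theorem WConst.monotone_pi (ρ σ : WTy) : WTy.Monotone _ (WConst.pi ρ σ).eval :=
  WTy.monotone_arr_iff.2 fun _ _ h _ _ _ => ⟨h, h.right⟩

theorem WConst.monotone_sig (ρ σ γ : WTy) : WTy.Monotone _ (WConst.sig ρ σ γ).eval :=
  WTy.monotone_arr_iff.2 fun _ _ hf _ _ hg =>
    have key : ∀ {f f' : (γ ⇾ σ ⇾ ρ).Interp} {g g' : (γ ⇾ σ).Interp},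
        WTy.Maj _ f f' → WTy.Maj _ g g' → WTy.Maj (γ ⇾ ρ) (fun z => f z (g z))
          (fun z => f' z (g' z)) :=
      fun h h' z w hzw => ⟨((h z w hzw).1 _ _ (h' z w hzw).1).1, ((h z w hzw).2 _ _ (h' z w hzw).2).1⟩
    ⟨key hf hg, key hf.right hg⟩

theorem WConst.monotone_sing (σ : WTy) : WTy.Monotone _ (WConst.sing σ).eval :=
  WTy.monotone_arr_iff.2 fun _ y h =>
    ⟨fun _ hu => ⟨y, rfl, hu ▸ h⟩, fun _ hv => hv ▸ h.right⟩

theorem WConst.monotone_union (σ : WTy) : WTy.Monotone _ (WConst.union σ).eval := by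
  have key : ∀ {a b c d : (WTy.star σ).Interp}, WTy.Maj _ a b → WTy.Maj _ c d →
      WTy.Maj _ ((WConst.union σ).eval a c) ((WConst.union σ).eval b d) := by
    intro a b c d h h'
    constructor
    · rintro u (hu | hu)
      · obtain ⟨v, hv, huv⟩ := h.1 u hu
        exact ⟨v, Or.inl hv, huv⟩
      · obtain ⟨v, hv, huv⟩ := h'.1 u hu
        exact ⟨v, Or.inr hv, huv⟩
    · rintro v (hv | hv)
      exacts [h.2 v hv, h'.2 v hv]
  exact WTy.monotone_arr_iff.2 fun _ _ h _ _ h' => ⟨key h h', key h.right h'⟩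

theorem WConst.monotone_bigUnion (σ τ : WTy) : WTy.Monotone _ (WConst.bigUnion σ τ).eval := by
  have key : ∀ {a b : (WTy.star σ).Interp} {f g : (σ ⇾ .star τ).Interp}, WTy.Maj _ a b →
      WTy.Maj _ f g → WTy.Maj _ ((WConst.bigUnion σ τ).eval a f)
        ((WConst.bigUnion σ τ).eval b g) := by
    intro a b f g h h'
    constructor
    · intro u hu
      obtain ⟨x, hx, hux⟩ := Set.mem_iUnion₂.1 hu
      obtain ⟨y, hy, hxy⟩ := h.1 x hx
      obtain ⟨v, hv, huv⟩ := (h' x y hxy).1.1 u hux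
      exact ⟨v, Set.mem_biUnion hy hv, huv⟩
    · intro v hv
      obtain ⟨y, hy, hvy⟩ := Set.mem_iUnion₂.1 hv
      exact (h' y y (h.2 y hy)).2.2 v hvy
  exact WTy.monotone_arr_iff.2 fun _ _ h _ _ h' => ⟨key h h', key h.right h'⟩

theorem WConst.monotone_zero : WTy.Monotone _ WConst.zero.eval := Nat.le_refl 0

theorem WConst.monotone_succ : WTy.Monotone _ WConst.succ.eval :=
  WTy.monotone_arr_iff.2 fun _ _ h => Nat.succ_le_succ h

theorem Imb.isWitnessStructure : Imb.IsWitnessStructure where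
  app _ _ _ _ hf hx := WTy.Monotone.app hf hx
  star _ _ := WTy.monotone_star_iff
  pi := WConst.monotone_pi
  sig := WConst.monotone_sig
  sing := WConst.monotone_sing
  union := WConst.monotone_union
  bigUnion := WConst.monotone_bigUnion
  zero := WConst.monotone_zero
  succ := WConst.monotone_succ
  max := WConst.monotone_max

/-! ### Witnessing functions -/

/-- Functions of tuples which are explicitly definable from closed witnessing terms. -/
inductive Definable : {Γ : List WTy} → {ρ : WTy} → (WTuple Γ → ρ.Interp) → Prop
  | head {Γ : List WTy} {ρ : WTy} : Definable (Γ := ρ :: Γ) (ρ := ρ) fun e => e.1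
  | weaken {Γ : List WTy} {σ ρ : WTy} {F : WTuple Γ → ρ.Interp} :
      Definable F → Definable (Γ := σ :: Γ) (ρ := ρ) fun e => F e.2
  | term {Γ : List WTy} {ρ : WTy} (t : WTm ρ) : Definable (Γ := Γ) (ρ := ρ) fun _ => t.eval
  | app {Γ : List WTy} {ρ τ : WTy} {F : WTuple Γ → (ρ ⇾ τ).Interp} {G : WTuple Γ → ρ.Interp} :
      Definable F → Definable G → Definable (ρ := τ) fun e => F e (G e)

/-- The conclusion of combinatory completeness: definable functions without arguments are values of
closed terms, and the first argument of a definable function can be abstracted. -/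
def Definable.Abstract {ρ : WTy} : {Γ : List WTy} → (WTuple Γ → ρ.Interp) → Prop
  | [], F => ∃ t : WTm ρ, t.eval = F ()
  | σ :: Γ, F => Definable (Γ := Γ) (ρ := σ ⇾ ρ) fun e x => F (x, e)

/-- Bracket abstraction: the identity is `Σ Π Π`, a function independent of the abstracted argument
is prefixed by `Π`, and `Σ` distributes the argument over an application. -/
theorem Definable.abstract {Γ : List WTy} {ρ : WTy} {F : WTuple Γ → ρ.Interp}
    (h : Definable F) : Definable.Abstract F := by
  induction h with
  | @head Γ ρ =>
    exact Definable.term (ρ := ρ ⇾ ρ)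
      (.app (.app (.const (.sig ρ (ρ ⇾ ρ) ρ)) (.const (.pi ρ (ρ ⇾ ρ)))) (.const (.pi ρ ρ)))
  | @weaken Γ σ ρ F hF _ =>
    exact Definable.app (Definable.term (.const (.pi ρ σ))) hF
  | @term Γ ρ t =>
    cases Γ with
    | nil => exact ⟨t, rfl⟩
    | cons σ Γ => exact Definable.term (.app (.const (.pi ρ σ)) t)
  | @app Γ ρ τ F G _ _ hF hG =>
    cases Γ with
    | nil =>
      obtain ⟨t, ht⟩ := hF
      obtain ⟨s, hs⟩ := hG
      exact ⟨.app t s, by rw [WTm.eval, ht, hs]⟩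
    | cons σ Γ =>
      exact Definable.app (Definable.app (Definable.term (.const (.sig τ ρ σ))) hF) hG

/-- Functions of tuples which are definable from closed witnessing terms and monotone. -/
structure Witnessing {Γ : List WTy} {ρ : WTy} (F : WTuple Γ → ρ.Interp) : Prop where
  definable : Definable F
  maj : ∀ e e', WTuple.Maj e e' → ρ.Maj (F e) (F e')

/-- Tuples of witnessing functions. -/
def Witnessings {Γ : List WTy} : {m : List WTy} → (WTuple Γ → WTuple m) → Prop
  | [], _ => True
  | ρ :: _, F => Witnessing (ρ := ρ) (fun e => (F e).1) ∧ Witnessings fun e => (F e).2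

/-! ### Closure properties of witnessing functions -/

namespace Witnessing

variable {Γ : List WTy} {ρ σ τ : WTy}

theorem head : Witnessing (Γ := ρ :: Γ) (ρ := ρ) fun e => e.1 :=
  ⟨.head, fun _ _ h => h.1⟩

theorem weaken {F : WTuple Γ → ρ.Interp} (hF : Witnessing F) :
    Witnessing (Γ := σ :: Γ) (ρ := ρ) fun e => F e.2 :=
  ⟨.weaken hF.definable, fun _ _ h => hF.maj _ _ h.2⟩

theorem const {c : WConst ρ} (hc : ρ.Monotone c.eval) :
    Witnessing (Γ := Γ) (ρ := ρ) fun _ => c.eval :=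
  ⟨.term (.const c), fun _ _ _ => hc⟩

theorem app {F : WTuple Γ → (ρ ⇾ τ).Interp} {G : WTuple Γ → ρ.Interp} (hF : Witnessing F)
    (hG : Witnessing G) : Witnessing (ρ := τ) fun e => F e (G e) :=
  ⟨.app hF.definable hG.definable, fun _ _ h => (hF.maj _ _ h _ _ (hG.maj _ _ h)).1⟩

/-- The two clauses of majorizability at the function type are the monotonicity of `F` at `(x, e) ≤
(y, e')` and at `(x, e') ≤ (y, e')`. -/
theorem lam {F : WTuple (σ :: Γ) → ρ.Interp} (hF : Witnessing F) :
    Witnessing (Γ := Γ) (ρ := σ ⇾ ρ) fun e x => F (x, e) :=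
  ⟨hF.definable.abstract, fun _ _ h _ _ hx =>
    ⟨hF.maj _ _ ⟨hx, h⟩, hF.maj _ _ ⟨hx, h.right⟩⟩⟩

theorem comp_definable {F : WTuple Γ → ρ.Interp} (hF : Definable F) :
    ∀ {Δ : List WTy} {G : WTuple Δ → WTuple Γ}, Witnessings G → Definable fun e => F (G e) := by
  induction hF with
  | head => exact fun hG => hG.1.definable
  | weaken _ ih => exact fun hG => ih hG.2
  | term t => exact fun _ => .term t
  | app _ _ ih ih' => exact fun hG => .app (ih hG) (ih' hG)

end Witnessing

namespace Witnessings

variable {Γ : List WTy} {m : List WTy}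

theorem maj : ∀ {m : List WTy} {F : WTuple Γ → WTuple m}, Witnessings F →
    ∀ e e', WTuple.Maj e e' → WTuple.Maj (F e) (F e')
  | [], _, _, _, _, _ => trivial
  | _ :: _, _, hF, e, e', h => ⟨hF.1.maj e e' h, maj hF.2 e e' h⟩

theorem mono {F : WTuple Γ → WTuple m} (hF : Witnessings F) {e : WTuple Γ} (he : WTuple.Mono e) :
    WTuple.Mono (F e) :=
  (hF.maj _ _ he.maj).mono_right

end Witnessings

theorem Witnessing.comp {Γ Δ : List WTy} {ρ : WTy} {F : WTuple Γ → ρ.Interp}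
    {G : WTuple Δ → WTuple Γ} (hF : Witnessing F) (hG : Witnessings G) :
    Witnessing fun e => F (G e) :=
  ⟨Witnessing.comp_definable hF.definable hG, fun e e' h => hF.maj _ _ (hG.maj e e' h)⟩

namespace Witnessings

variable {Γ Δ : List WTy} {σ : WTy}

theorem comp : ∀ {m : List WTy} {F : WTuple Γ → WTuple m} {G : WTuple Δ → WTuple Γ},
    Witnessings F → Witnessings G → Witnessings fun e => F (G e)
  | [], _, _, _, _ => trivial
  | _ :: _, _, _, hF, hG => ⟨hF.1.comp hG, comp hF.2 hG⟩

theorem weaken : ∀ {m : List WTy} {F : WTuple Γ → WTuple m}, Witnessings F →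
    Witnessings (Γ := σ :: Γ) fun e => F e.2
  | [], _, _ => trivial
  | _ :: _, _, hF => ⟨hF.1.weaken, weaken hF.2⟩

theorem id : ∀ {m : List WTy}, Witnessings fun e : WTuple m => e
  | [] => trivial
  | _ :: _ => ⟨.head, id.weaken⟩

theorem left : ∀ {l m : List WTy}, Witnessings (Γ := l ++ m) (m := l) fun e => Tuple.left e
  | [], _ => trivial
  | _ :: _, _ => ⟨.head, left.weaken⟩

theorem right : ∀ {l m : List WTy}, Witnessings (Γ := l ++ m) (m := m) fun e => Tuple.right (l := l) e
  | [], _ => id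
  | _ :: l, _ => (right (l := l)).weaken

theorem append : ∀ {l m : List WTy} {F : WTuple Γ → WTuple l} {G : WTuple Γ → WTuple m},
    Witnessings F → Witnessings G → Witnessings fun e => (F e).append (G e)
  | [], _, _, _, _, hG => hG
  | _ :: _, _, _, _, hF, hG => ⟨hF.1, append hF.2 hG⟩

theorem exists_term : ∀ {m : List WTy} {a : WTuple m}, Witnessings (Γ := []) (fun _ => a) →
    ∃ t : Tuple WTm m, (t.map fun _ s => s.eval : WTuple m) = a
  | [], _, _ => ⟨(), rfl⟩
  | _ :: _, _, h => by
    obtain ⟨t, ht⟩ := h.1.definable.abstract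
    obtain ⟨s, hs⟩ := exists_term h.2
    exact ⟨(t, s), Prod.ext ht hs⟩

theorem of_term : ∀ {m : List WTy} (t : Tuple WTm m),
    WTuple.Mono (t.map fun _ s => s.eval : WTuple m) →
    Witnessings (Γ := Γ) fun _ => (t.map fun _ s => s.eval : WTuple m)
  | [], _, _ => trivial
  | _ :: _, t, h => ⟨⟨.term t.1, fun _ _ _ => h.1⟩, of_term t.2 h.2⟩

/-- Testing against the projections suffices. This is useful when a tuple is accessible only through
its continuations, as in `Witnessings.iter`. -/
theorem of_comp : ∀ {m : List WTy} {F : WTuple Γ → WTuple m},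
    (∀ {τ : WTy} {P : WTuple m → τ.Interp}, Witnessing P → Witnessing fun e => P (F e)) →
    Witnessings F
  | [], _, _ => trivial
  | _ :: _, _, h => ⟨h .head, of_comp fun hP => h hP.weaken⟩

end Witnessings

/-! ### Abstraction and application of tuples -/

/-- `λ a₁ … aₙ. F (a₁, …, aₙ)`. -/
def curryAll : {l : List WTy} → {τ : WTy} → (WTuple l → τ.Interp) → (WTy.arrs l τ).Interp
  | [], _, F => F ()
  | _ :: _, _, F => fun x => curryAll fun a => F (x, a)

@[simp] theorem applyAll_curryAll : ∀ {l : List WTy} {τ : WTy} (F : WTuple l → τ.Interp)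
    (a : WTuple l), applyAll (curryAll F) a = F a
  | [], _, _, _ => rfl
  | _ :: _, _, F, a => applyAll_curryAll (fun b => F (a.1, b)) a.2

/-- `λ a. (F₁ a, …, Fₖ a)`, as a tuple of functionals. -/
def curryTuple {l : List WTy} : {m : List WTy} → (WTuple l → WTuple m) →
    WTuple (m.map (WTy.arrs l))
  | [], _ => ()
  | _ :: _, F => (curryAll fun a => (F a).1, curryTuple fun a => (F a).2)

@[simp] theorem appTuple_curryTuple {l : List WTy} : ∀ {m : List WTy} (F : WTuple l → WTuple m)
    (a : WTuple l), appTuple (curryTuple F) a = F a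
  | [], _, _ => rfl
  | _ :: _, F, a => Prod.ext (applyAll_curryAll _ _) (appTuple_curryTuple (fun b => (F b).2) a)

variable {Γ : List WTy}

/-- Moves the first variable of the block to be abstracted over to the parameters, as the recursions
on this block in `Witnessing.curryAll` and `Witnessing.bigUnionAll` require. -/
theorem Witnessing.rotate {l Γ : List WTy} {ρ τ : WTy} {F : WTuple (ρ :: l) → WTuple Γ → τ.Interp}
    (hF : Witnessing (Γ := ρ :: l ++ Γ) fun u => F u.left (u.right (l := ρ :: l))) :
    Witnessing (Γ := l ++ ρ :: Γ) fun u =>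
      F ((u.right (l := l)).1, u.left) (u.right (l := l)).2 := by
  have hr := Witnessings.right (l := l) (m := ρ :: Γ)
  have := Witnessing.comp (Γ := ρ :: (l ++ Γ)) (Δ := l ++ ρ :: Γ) hF
    (G := fun u => ((Tuple.right (l := l) u).1, u.left.append (Tuple.right (l := l) u).2))
    ⟨hr.1, Witnessings.left.append hr.2⟩
  simpa [Tuple.left, Tuple.right] using this

theorem Witnessing.curryAll : ∀ {l Γ : List WTy} {τ : WTy} {F : WTuple l → WTuple Γ → τ.Interp},
    Witnessing (Γ := l ++ Γ) (fun u => F u.left (u.right (l := l))) →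
    Witnessing fun e => curryAll fun a => F a e
  | [], _, _, _, hF => hF
  | ρ :: l, Γ, τ, F, hF => by
    refine Witnessing.lam (F := fun u : WTuple (ρ :: Γ) => FunInt.curryAll fun a => F (u.1, a) u.2)
      (Witnessing.curryAll (F := fun a (u : WTuple (ρ :: Γ)) => F (u.1, a) u.2) ?_)
    exact hF.rotate

theorem Witnessings.curryTuple {l : List WTy} : ∀ {m : List WTy} {F : WTuple l → WTuple Γ → WTuple m},
    Witnessings (Γ := l ++ Γ) (fun u => F u.left (u.right (l := l))) →
    Witnessings fun e => curryTuple fun a => F a e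
  | [], _, _ => trivial
  | _ :: _, F, hF => ⟨Witnessing.curryAll (F := fun a e => (F a e).1) hF.1,
      Witnessings.curryTuple (F := fun a e => (F a e).2) hF.2⟩

theorem Witnessing.applyAll : ∀ {l : List WTy} {τ : WTy} {F : WTuple Γ → (WTy.arrs l τ).Interp}
    {G : WTuple Γ → WTuple l}, Witnessing F → Witnessings G →
    Witnessing fun e => applyAll (F e) (G e)
  | [], _, _, _, hF, _ => hF
  | _ :: l, _, _, _, hF, hG => Witnessing.applyAll (l := l) (hF.app hG.1) hG.2

theorem Witnessings.appTuple {l : List WTy} : ∀ {m : List WTy}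
    {F : WTuple Γ → WTuple (m.map (WTy.arrs l))} {G : WTuple Γ → WTuple l},
    Witnessings F → Witnessings G → Witnessings fun e => appTuple (F e) (G e)
  | [], _, _, _, _ => trivial
  | _ :: _, _, _, hF, hG => ⟨hF.1.applyAll hG, Witnessings.appTuple hF.2 hG⟩

theorem WTy.maj_arrs_iff : ∀ {l : List WTy} {τ : WTy} {f g : (WTy.arrs l τ).Interp},
    (WTy.arrs l τ).Maj f g ↔ ∀ a b, WTuple.Maj a b →
      τ.Maj (applyAll f a) (applyAll g b) ∧ τ.Maj (applyAll g a) (applyAll g b)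
  | [], _, _, _ => ⟨fun h _ _ _ => ⟨h, h.right⟩, fun h => (h () () trivial).1⟩
  | _ :: _, _, _, _ => by
    constructor
    · intro h a b hab
      exact ⟨(WTy.maj_arrs_iff.1 (h _ _ hab.1).1 _ _ hab.2).1,
        (WTy.maj_arrs_iff.1 (h _ _ hab.1).2 _ _ hab.2).1⟩
    · intro h x y hxy
      exact ⟨WTy.maj_arrs_iff.2 fun a b hab => ⟨(h (x, a) (y, b) ⟨hxy, hab⟩).1,
          (h (y, a) (y, b) ⟨hxy.right, hab⟩).2⟩,
        WTy.maj_arrs_iff.2 fun a b hab => ⟨(h (x, a) (y, b) ⟨hxy, hab⟩).2,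
          (h (y, a) (y, b) ⟨hxy.right, hab⟩).2⟩⟩

theorem WTuple.Maj.appTuple {l m : List WTy} {f g : WTuple (m.map (WTy.arrs l))} {a b : WTuple l}
    (hf : WTuple.Maj f g) (ha : WTuple.Maj a b) : WTuple.Maj (appTuple f a) (appTuple g b) := by
  induction m with
  | nil => trivial
  | cons ρ m ih => exact ⟨(WTy.maj_arrs_iff.1 hf.1 a b ha).1, ih hf.2⟩

theorem WTuple.Mono.appTuple {l m : List WTy} {f : WTuple (m.map (WTy.arrs l))} {a : WTuple l}
    (hf : WTuple.Mono f) (ha : WTuple.Mono a) : WTuple.Mono (appTuple f a) :=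
  (hf.maj.appTuple ha.maj).mono_right

/-! ### Default elements, joins, singletons and unions -/

/-- A default element of each witnessing type. -/
def WTy.zero : (ρ : WTy) → ρ.Interp
  | .nat => (0 : ℕ)
  | .arr _ τ => fun _ => τ.zero
  | .star ρ => ⟨{ρ.zero}, Set.singleton_nonempty _, Set.finite_singleton _⟩

theorem Witnessing.zero : ∀ {ρ : WTy} {Γ : List WTy}, Witnessing (Γ := Γ) fun _ => ρ.zero
  | .nat, _ => .const WConst.monotone_zero
  | .arr ρ _, Γ => Witnessing.lam (Witnessing.zero (Γ := ρ :: Γ))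
  | .star ρ, _ => Witnessing.app (.const (WConst.monotone_sing ρ)) Witnessing.zero

/-- Tuples of default elements. -/
def WTuple.zero : (l : List WTy) → WTuple l
  | [] => ()
  | ρ :: l => (ρ.zero, WTuple.zero l)

theorem Witnessings.zero : ∀ {m : List WTy}, Witnessings (Γ := Γ) fun _ => WTuple.zero m
  | [] => trivial
  | _ :: _ => ⟨.zero, .zero⟩

theorem Witnessing.union {ρ : WTy} {F G : WTuple Γ → (WTy.star ρ).Interp} (hF : Witnessing F)
    (hG : Witnessing G) : Witnessing fun e => (WConst.union ρ).eval (F e) (G e) :=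
  ((Witnessing.const (WConst.monotone_union ρ)).app hF).app hG

theorem Witnessing.sing {ρ : WTy} {F : WTuple Γ → ρ.Interp} (hF : Witnessing F) :
    Witnessing fun e => (WConst.sing ρ).eval (F e) :=
  (Witnessing.const (WConst.monotone_sing ρ)).app hF

theorem Witnessing.join : ∀ {ρ : WTy} {Γ : List WTy} {F G : WTuple Γ → ρ.Interp}, Witnessing F →
    Witnessing G → Witnessing fun e => ρ.join (F e) (G e)
  | .nat, _, _, _, hF, hG => (Witnessing.const WConst.monotone_max).app (hF.sing.union hG.sing)
  | .arr _ _, _, _, _, hF, hG =>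
      Witnessing.lam (Witnessing.join (hF.weaken.app .head) (hG.weaken.app .head))
  | .star _, _, _, _, hF, hG => hF.union hG

theorem Witnessings.join : ∀ {m : List WTy} {F G : WTuple Γ → WTuple m}, Witnessings F →
    Witnessings G → Witnessings fun e => WTuple.join (F e) (G e)
  | [], _, _, _, _ => trivial
  | _ :: _, _, _, hF, hG => ⟨hF.1.join hG.1, Witnessings.join hF.2 hG.2⟩

theorem WTy.Monotone.join {ρ : WTy} {x y : ρ.Interp} (hx : ρ.Monotone x) (hy : ρ.Monotone y) :
    ρ.Monotone (ρ.join x y) :=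
  (Witnessing.join (Γ := [ρ, ρ]) .head (Witnessing.weaken .head)).maj (x, y, ()) (x, y, ())
    ⟨hx, hy, trivial⟩

theorem WTuple.Mono.join : ∀ {l : List WTy} {p q : WTuple l}, WTuple.Mono p → WTuple.Mono q →
    WTuple.Mono (WTuple.join p q)
  | [], _, _, _, _ => trivial
  | _ :: _, _, _, hp, hq => ⟨hp.1.join hq.1, WTuple.Mono.join hp.2 hq.2⟩

/-- `({a₁}, …, {aₙ})`. -/
noncomputable def singTuple : {m : List WTy} → WTuple m → WTuple (m.map WTy.star)
  | [], _ => ()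
  | ρ :: _, a => ((WConst.sing ρ).eval a.1, singTuple a.2)

theorem Witnessings.singTuple : ∀ {m : List WTy} {F : WTuple Γ → WTuple m}, Witnessings F →
    Witnessings fun e => singTuple (F e)
  | [], _, _ => trivial
  | _ :: _, _, hF => ⟨hF.1.sing, Witnessings.singTuple hF.2⟩

theorem memTuple_singTuple : ∀ {m : List WTy} (a : WTuple m), memTuple a (singTuple a)
  | [], _ => trivial
  | _ :: _, a => ⟨rfl, memTuple_singTuple a.2⟩

/-- Concatenation of tuples of finite sets. -/
def appendStar : {l m : List WTy} → WTuple (l.map WTy.star) → WTuple (m.map WTy.star) →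
    WTuple ((l ++ m).map WTy.star)
  | [], _, _, q => q
  | _ :: _, _, p, q => (p.1, appendStar p.2 q)

theorem Witnessings.appendStar : ∀ {l m : List WTy} {F : WTuple Γ → WTuple (l.map WTy.star)}
    {G : WTuple Γ → WTuple (m.map WTy.star)}, Witnessings F → Witnessings G →
    Witnessings fun e => appendStar (F e) (G e)
  | [], _, _, _, _, hG => hG
  | _ :: _, _, _, _, hF, hG => ⟨hF.1, Witnessings.appendStar hF.2 hG⟩

theorem memTuple_appendStar : ∀ {l m : List WTy} {a : WTuple l} {b : WTuple m}
    {A : WTuple (l.map WTy.star)} {B : WTuple (m.map WTy.star)}, memTuple a A → memTuple b B →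
    memTuple (a.append b) (appendStar A B)
  | [], _, _, _, _, _, _, h => h
  | _ :: _, _, _, _, _, _, h, h' => ⟨h.1, memTuple_appendStar h.2 h'⟩

/-- `⋃ F b`, where `b` ranges over the tuples that belong to `B`. -/
noncomputable def bigUnionAll {τ : WTy} : {m : List WTy} → WTuple (m.map WTy.star) →
    (WTuple m → (WTy.star τ).Interp) → (WTy.star τ).Interp
  | [], _, F => F ()
  | ρ :: _, B, F => (WConst.bigUnion ρ τ).eval B.1 fun x => bigUnionAll B.2 fun b => F (x, b)

theorem mem_bigUnionAll {τ : WTy} : ∀ {m : List WTy} {B : WTuple (m.map WTy.star)}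
    {F : WTuple m → (WTy.star τ).Interp} {b : WTuple m} {x : τ.Interp}, memTuple b B →
    x ∈ (F b).1 → x ∈ (bigUnionAll B F).1
  | [], _, _, _, _, _, h => h
  | _ :: _, _, F, b, _, hb, h => Set.mem_biUnion hb.1
      (mem_bigUnionAll (F := fun c => F (b.1, c)) hb.2 h)

theorem Witnessing.bigUnionAll {τ : WTy} : ∀ {m Γ : List WTy}
    {B : WTuple Γ → WTuple (m.map WTy.star)} {F : WTuple m → WTuple Γ → (WTy.star τ).Interp},
    Witnessings B → Witnessing (Γ := m ++ Γ) (fun u => F u.left (u.right (l := m))) →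
    Witnessing fun e => bigUnionAll (B e) fun b => F b e
  | [], _, _, _, _, hF => hF
  | ρ :: m, Γ, B, F, hB, hF => by
    refine ((Witnessing.const (WConst.monotone_bigUnion ρ τ)).app hB.1).app
      (Witnessing.lam (F := fun u : WTuple (ρ :: Γ) => FunInt.bigUnionAll (B u.2).2
        fun b => F (u.1, b) u.2)
      (Witnessing.bigUnionAll (F := fun b (u : WTuple (ρ :: Γ)) => F (u.1, b) u.2)
        hB.2.weaken ?_))
    exact hF.rotate

/-- `(⋃ F₁ b, …, ⋃ Fₖ b)`, where `b` ranges over the tuples that belong to `B`. -/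
noncomputable def bigUnionTuple {m : List WTy} (B : WTuple (m.map WTy.star)) : {k : List WTy} →
    (WTuple m → WTuple (k.map WTy.star)) → WTuple (k.map WTy.star)
  | [], _ => ()
  | _ :: _, F => (bigUnionAll B fun b => (F b).1, bigUnionTuple B fun b => (F b).2)

theorem memTuple_bigUnionTuple {m : List WTy} {B : WTuple (m.map WTy.star)} {b : WTuple m}
    (hb : memTuple b B) : ∀ {k : List WTy} {F : WTuple m → WTuple (k.map WTy.star)} {c : WTuple k},
    memTuple c (F b) → memTuple c (bigUnionTuple B F)
  | [], _, _, _ => trivial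
  | _ :: _, F, _, h => ⟨mem_bigUnionAll (F := fun b => (F b).1) hb h.1,
      memTuple_bigUnionTuple hb (F := fun b => (F b).2) h.2⟩

theorem Witnessings.bigUnionTuple {m : List WTy} {B : WTuple Γ → WTuple (m.map WTy.star)}
    (hB : Witnessings B) : ∀ {k : List WTy} {F : WTuple m → WTuple Γ → WTuple (k.map WTy.star)},
    Witnessings (Γ := m ++ Γ) (fun u => F u.left (u.right (l := m))) →
    Witnessings fun e => bigUnionTuple (B e) fun b => F b e
  | [], _, _ => trivial
  | _ :: _, F, hF => ⟨Witnessing.bigUnionAll (F := fun b e => (F b e).1) hB hF.1,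
      Witnessings.bigUnionTuple hB (F := fun b e => (F b e).2) hF.2⟩

/-! ### Recursion with an inflationary step -/

/-- Witnessing functions are closed under primitive recursion if the step is inflationary. -/
theorem Witnessing.natRec {ρ : WTy} {W : WTuple Γ → ρ.Interp}
    {S : WTuple (ρ :: .nat :: Γ) → ρ.Interp} (hW : Witnessing W) (hS : Witnessing S)
    (hle : ∀ (e : WTuple Γ) (k : ℕ) (x : ρ.Interp), WTuple.Mono e → ρ.Monotone x →
      ρ.Maj x (S (x, k, e))) :
    Witnessing (Γ := .nat :: Γ) (ρ := ρ) fun u =>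
      Nat.rec (motive := fun _ => ρ.Interp) (W u.2) (fun k r => S (r, k, u.2)) u.1 := by
  have h0 := Definable.app (Definable.app (Definable.app (Definable.term (.const (.recur ρ))) .head)
    hW.weaken.definable) hS.lam.lam.weaken.definable
  refine ⟨h0, ?_⟩
  have h1 : ∀ (e e' : WTuple Γ), WTuple.Maj e e' → ∀ n : ℕ,
      ρ.Maj (Nat.rec (motive := fun _ => ρ.Interp) (W e) (fun k r => S (r, k, e)) n)
        (Nat.rec (motive := fun _ => ρ.Interp) (W e') (fun k r => S (r, k, e')) n) := by
    intro e e' h n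
    induction n with
    | zero => exact hW.maj _ _ h
    | succ n ih => exact hS.maj _ _ ⟨ih, Nat.le_refl n, h⟩
  rintro ⟨n, e⟩ ⟨n', e'⟩ ⟨hn, h⟩
  change WTuple.Maj e e' at h
  -- The parameters go from `e` to `e'` with `n` fixed; then `n` grows to `n'`, and each additional
  -- step is inflationary.
  refine (h1 _ _ h n).trans ?_
  change (n : ℕ) ≤ n' at hn
  induction hn with
  | refl => exact h1 _ _ h.right _
  | step _ ih => exact ih.trans (hle _ _ _ h.mono_right (h1 _ _ h.right _))

/-- Simultaneous recursion. -/
def WTuple.iter {m : List WTy} (a : WTuple m) (S : WTuple m → ℕ → WTuple m) : ℕ → WTuple m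
  | 0 => a
  | k + 1 => S (WTuple.iter a S k) k

theorem curryAll_maj {l : List WTy} {τ : WTy} {f : (WTy.arrs l τ).Interp} {F : WTuple l → τ.Interp}
    (h : ∀ a b, WTuple.Maj a b → τ.Maj (applyAll f a) (F b) ∧ τ.Maj (F a) (F b)) :
    (WTy.arrs l τ).Maj f (curryAll F) :=
  WTy.maj_arrs_iff.2 fun a b hab => by simpa using h a b hab

/-- Witnessing functions are closed under simultaneous recursion if the step is inflationary. The
recursion is reduced to a single one for the functionals `c ↦ c a₁ … aₖ`. -/
theorem Witnessings.iter {m : List WTy} {W : WTuple Γ → WTuple m}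
    {S : WTuple m → ℕ → WTuple Γ → WTuple m} {N : WTuple Γ → ℕ} (hW : Witnessings W)
    (hS : Witnessings (Γ := m ++ .nat :: Γ)
      fun u => S u.left (u.right (l := m)).1 (u.right (l := m)).2)
    (hle : ∀ (e : WTuple Γ) (k : ℕ) (a : WTuple m), WTuple.Mono e → WTuple.Mono a →
      WTuple.Maj a (S a k e)) (hN : Witnessing (ρ := .nat) N) :
    Witnessings fun e => WTuple.iter (W e) (fun a k => S a k e) (N e) := by
  suffices Witnessings (Γ := .nat :: Γ) fun u =>
      WTuple.iter (W u.2) (fun a k => S a k u.2) u.1 from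
    this.comp (Γ := .nat :: Γ) (G := fun e => (N e, e)) ⟨hN, .id⟩
  refine Witnessings.of_comp fun {τ P} hP => ?_
  -- The functionals are `K₀ c = c W` and `Kₖ₊₁ c = Kₖ (λ a. c (S a k))`, so that `Kₙ c` is `c`
  -- applied to the `n`-th iterate. This needs recursion at the single type `(m → τ) → τ` only.
  have hstep : Witnessing (Γ := (WTy.arrs m τ ⇾ τ) :: .nat :: Γ) (ρ := WTy.arrs m τ ⇾ τ)
      fun u c => u.1 (FunInt.curryAll fun a => FunInt.applyAll c (S a u.2.1 u.2.2)) := by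
    refine Witnessing.lam
      (F := fun v : WTuple (WTy.arrs m τ :: (WTy.arrs m τ ⇾ τ) :: .nat :: Γ) =>
        v.2.1 (FunInt.curryAll fun a => FunInt.applyAll v.1 (S a v.2.2.1 v.2.2.2)))
      (Witnessing.app (Witnessing.weaken .head) (Witnessing.curryAll ?_))
    have hr := Witnessings.right (l := m) (m := WTy.arrs m τ :: (WTy.arrs m τ ⇾ τ) :: .nat :: Γ)
    refine Witnessing.applyAll hr.1 ?_
    have := hS.comp (G := fun u : WTuple (m ++ WTy.arrs m τ :: (WTy.arrs m τ ⇾ τ) :: .nat :: Γ) =>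
      u.left.append (m := .nat :: Γ) (u.right (l := m)).2.2) (Witnessings.left.append hr.2.2)
    simpa using this
  have hrec := Witnessing.natRec (ρ := WTy.arrs m τ ⇾ τ) (Γ := Γ)
    (W := fun e c => applyAll c (W e))
    (Witnessing.lam (F := fun u : WTuple (WTy.arrs m τ :: Γ) => FunInt.applyAll u.1 (W u.2))
      (Witnessing.head.applyAll hW.weaken)) hstep ?_
  -- The continuation is taken to be `P` itself.
  · have hc := Witnessing.curryAll (Γ := .nat :: Γ) (l := m) (F := fun a _ => P a)
      (hP.comp Witnessings.left)
    have := hrec.app hc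
    convert this using 2 with u
    obtain ⟨n, e⟩ := u
    suffices ∀ c : (WTy.arrs m τ).Interp,
        Nat.rec (motive := fun _ => (WTy.arrs m τ ⇾ τ).Interp) (fun c => applyAll c (W e))
          (fun k r c => r (curryAll fun a => applyAll c (S a k e))) n c =
          applyAll c (WTuple.iter (W e) (fun a k => S a k e) n) by
      refine Eq.trans ?_ (this _).symm
      rw [applyAll_curryAll]
    induction n with
    | zero => exact fun _ => rfl
    | succ n ih => exact fun c => (ih _).trans (applyAll_curryAll _ _)
  -- The step on functionals inherits inflation from `S`: `a ≤ b ≤ S b k` gives `c a ≤ c' (S b k)`,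
  -- hence `c` is majorized by `λ a. c' (S a k)`, and `K` is monotone.
  · intro e k K he hK c c' hc
    refine ⟨(hK _ _ (curryAll_maj fun a b hab => ?_)).1,
      (hstep.maj (K, k, e) (K, k, e) ⟨hK, Nat.le_refl k, he.maj⟩ c c' hc).1⟩
    have h : WTuple.Maj (S a k e) (S b k e) := by
      let ke : WTuple (.nat :: Γ) := (k, e)
      have hke : WTuple.Maj ke ke := ⟨Nat.le_refl k, he.maj⟩
      have hab' : WTuple.Maj (Tuple.append a ke) (Tuple.append b ke) := Tuple.Rel.append hab hke
      simpa using hS.maj _ _ hab'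
    exact ⟨(WTy.maj_arrs_iff.1 hc _ _ (hab.trans (hle e k b he hab.mono_right))).1,
      (WTy.maj_arrs_iff.1 hc.right _ _ h).1⟩

/-! ### The witnesses for induction -/

section Induction

variable {p n : List WTy}

/-- The types of the positive witnesses of `A → A'`, if those of the positive and the negative
witnesses of `A` and of `A'` are `p` and `n`. -/
abbrev stepTypes (p n : List WTy) : List WTy :=
  p.map (WTy.arrs p) ++ (n.map WTy.star).map (WTy.arrs (p ++ n))

/-- The iterates `a₀`, `a₁ = a₀ ∨ f a₀`, `a₂ = a₁ ∨ f a₁`, … -/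
noncomputable def posIter (fg : WTuple (stepTypes p n)) (a : WTuple p) : ℕ → WTuple p :=
  WTuple.iter a fun c _ => c.join (appTuple fg.left c)

/-- The sets `{a₀, …, aₖ}` of iterates. -/
noncomputable def posSet (fg : WTuple (stepTypes p n)) (a : WTuple p) : ℕ → WTuple (p.map WTy.star) :=
  WTuple.iter (singTuple a) fun C k => C.join (singTuple (posIter fg a (k + 1)))

/-- The sets of the negative witnesses that are needed in `k` steps. -/
noncomputable def negSet (fg : WTuple (stepTypes p n)) (C : WTuple (p.map WTy.star)) (b : WTuple n) :
    ℕ → WTuple (n.map WTy.star) :=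
  WTuple.iter (singTuple b) fun B _ =>
    B.join (bigUnionTuple (appendStar C B) fun ab => appTuple fg.right ab)

theorem WTuple.Mono.singTuple {m : List WTy} {a : WTuple m} (ha : WTuple.Mono a) :
    WTuple.Mono (singTuple a) :=
  (Witnessings.singTuple Witnessings.id).mono ha

theorem WTuple.Mono.appendStar : ∀ {l m : List WTy} {A : WTuple (l.map WTy.star)}
    {B : WTuple (m.map WTy.star)}, WTuple.Mono A → WTuple.Mono B → WTuple.Mono (appendStar A B)
  | [], _, _, _, _, h => h
  | _ :: _, _, _, _, h, h' => ⟨h.1, WTuple.Mono.appendStar h.2 h'⟩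

/-- The pair of `B` and `f` is regarded as the argument of a witnessing function, whose values at
monotone arguments are monotone. -/
theorem WTuple.Mono.bigUnionTuple {m k : List WTy} {B : WTuple (m.map WTy.star)}
    {f : WTuple ((k.map WTy.star).map (WTy.arrs m))} (hB : WTuple.Mono B) (hf : WTuple.Mono f) :
    WTuple.Mono (bigUnionTuple B fun b => FunInt.appTuple f b) := by
  have := (Witnessings.bigUnionTuple (Γ := m.map WTy.star ++ (k.map WTy.star).map (WTy.arrs m))
    (B := fun u => u.left) Witnessings.left
    (F := fun b u => FunInt.appTuple (u.right (l := m.map WTy.star)) b)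
    (Witnessings.appTuple (Witnessings.right.comp Witnessings.right) Witnessings.left)).mono
    (e := B.append f) (Tuple.All.append hB hf)
  simpa using this

theorem WTuple.Mono.maj_join_left {m : List WTy} {a b : WTuple m} (ha : WTuple.Mono a)
    (hb : WTuple.Mono b) : WTuple.Maj a (a.join b) :=
  (WTuple.le_join_left a b).maj ha (ha.join hb)

theorem WTuple.Mono.posIter {fg : WTuple (stepTypes p n)} {a : WTuple p} (hfg : WTuple.Mono fg)
    (ha : WTuple.Mono a) : ∀ k, WTuple.Mono (posIter fg a k)
  | 0 => ha
  | k + 1 => (WTuple.Mono.posIter hfg ha k).join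
      (WTuple.Mono.appTuple hfg.left (WTuple.Mono.posIter hfg ha k))

theorem WTuple.Mono.posSet {fg : WTuple (stepTypes p n)} {a : WTuple p} (hfg : WTuple.Mono fg)
    (ha : WTuple.Mono a) : ∀ k, WTuple.Mono (posSet fg a k)
  | 0 => ha.singTuple
  | k + 1 => (WTuple.Mono.posSet hfg ha k).join (WTuple.Mono.posIter hfg ha (k + 1)).singTuple

theorem WTuple.Mono.negSet {fg : WTuple (stepTypes p n)} {C : WTuple (p.map WTy.star)}
    {b : WTuple n} (hfg : WTuple.Mono fg) (hC : WTuple.Mono C) (hb : WTuple.Mono b) :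
    ∀ k, WTuple.Mono (negSet fg C b k)
  | 0 => hb.singTuple
  | k + 1 => (WTuple.Mono.negSet hfg hC hb k).join
      ((hC.appendStar (WTuple.Mono.negSet hfg hC hb k)).bigUnionTuple hfg.right)

theorem posIter_mem_posSet (fg : WTuple (stepTypes p n)) (a : WTuple p) {k N : ℕ} (h : k ≤ N) :
    memTuple (posIter fg a k) (posSet fg a N) := by
  induction h with
  | refl =>
    cases k with
    | zero => exact memTuple_singTuple _
    | succ k => exact memTuple_mono (WTuple.le_join_right _ _) (memTuple_singTuple _)
  | step _ ih => exact memTuple_mono (WTuple.le_join_left _ _) ih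

theorem WTuple.iter_le {m : List WTy} {a : WTuple m} {S : WTuple m → ℕ → WTuple m}
    (hS : ∀ c k, WTuple.Le c (S c k)) {k N : ℕ} (h : k ≤ N) :
    WTuple.Le (WTuple.iter a S k) (WTuple.iter a S N) := by
  induction h with
  | refl => exact .refl _
  | step _ ih => exact ih.trans (hS _ _)

/-- Joining with the previous iterate makes the step inflationary, so `Witnessings.iter` applies.
The same holds for `posSet` and `negSet`, where the join is a union. -/
theorem Witnessings.posIter {FG : WTuple Γ → WTuple (stepTypes p n)} {A : WTuple Γ → WTuple p}
    {N : WTuple Γ → ℕ} (hFG : Witnessings FG) (hA : Witnessings A) (hN : Witnessing (ρ := .nat) N) :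
    Witnessings fun e => posIter (FG e) (A e) (N e) := by
  have hr := Witnessings.right (l := p) (m := .nat :: Γ)
  have hFG' := (Witnessings.left.comp hFG).comp hr.2
  refine Witnessings.iter (S := fun c _ e => c.join (FunInt.appTuple (FG e).left c)) hA
    (Witnessings.left.join (hFG'.appTuple Witnessings.left)) ?_ hN
  exact fun e _ a he ha => ha.maj_join_left (WTuple.Mono.appTuple (hFG.mono he).left ha)

theorem Witnessings.posSet {FG : WTuple Γ → WTuple (stepTypes p n)} {A : WTuple Γ → WTuple p}
    {N : WTuple Γ → ℕ} (hFG : Witnessings FG) (hA : Witnessings A) (hN : Witnessing (ρ := .nat) N) :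
    Witnessings fun e => posSet (FG e) (A e) (N e) := by
  have hr := Witnessings.right (l := p.map WTy.star) (m := .nat :: Γ)
  have hk : Witnessing (ρ := .nat) fun u : WTuple (p.map WTy.star ++ .nat :: Γ) =>
      ((u.right (l := p.map WTy.star)).1 : ℕ) + 1 :=
    (Witnessing.const WConst.monotone_succ).app hr.1
  refine Witnessings.iter
    (S := fun C k e => C.join (FunInt.singTuple (FunInt.posIter (FG e) (A e) (k + 1))))
    hA.singTuple (Witnessings.left.join
      (Witnessings.posIter (hFG.comp hr.2) (hA.comp hr.2) hk).singTuple) ?_ hN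
  exact fun e k C he hC => hC.maj_join_left
    (WTuple.Mono.posIter (hFG.mono he) (hA.mono he) (k + 1)).singTuple

theorem Witnessings.negSet {FG : WTuple Γ → WTuple (stepTypes p n)}
    {C : WTuple Γ → WTuple (p.map WTy.star)} {B : WTuple Γ → WTuple n}
    {N : WTuple Γ → ℕ} (hFG : Witnessings FG) (hC : Witnessings C) (hB : Witnessings B)
    (hN : Witnessing (ρ := .nat) N) :
    Witnessings fun e => negSet (FG e) (C e) (B e) (N e) := by
  have hr := Witnessings.right (l := n.map WTy.star) (m := .nat :: Γ)
  have hFG' := (Witnessings.right.comp hFG).comp hr.2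
  refine Witnessings.iter
    (S := fun D _ e => D.join (FunInt.bigUnionTuple (FunInt.appendStar (C e) D)
      fun ab => FunInt.appTuple (FG e).right ab))
    hB.singTuple (Witnessings.left.join (Witnessings.bigUnionTuple
      ((hC.comp hr.2).appendStar Witnessings.left)
      (F := fun ab (u : WTuple (n.map WTy.star ++ .nat :: Γ)) =>
        FunInt.appTuple (FG (u.right (l := n.map WTy.star)).2).right ab)
      ((hFG'.comp Witnessings.right).appTuple Witnessings.left))) ?_ hN
  exact fun e _ D he hD => hD.maj_join_left
    (((hC.mono he).appendStar hD).bigUnionTuple (hFG.mono he).right)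

/-- The induction behind the interpretation of the induction axiom. -/
theorem rel_posIter {rel : ℕ → WTuple p → WTuple n → Prop}
    (hrel : ∀ k a a' b, WTuple.Mono a → WTuple.Mono a' → WTuple.Mono b → WTuple.Le a a' →
      rel k a b → rel k a' b)
    {fg : WTuple (stepTypes p n)} {a : WTuple p} {b : WTuple n} {N : ℕ}
    (hfg : WTuple.Mono fg) (ha : WTuple.Mono a) (hb : WTuple.Mono b)
    (hzero : ∀ d, memTuple d (negSet fg (posSet fg a N) b N) → rel 0 a d)
    (hsucc : ∀ k ≤ N, ∀ c d, memTuple c (posSet fg a N) →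
      memTuple d (negSet fg (posSet fg a N) b N) →
      (∀ d', memTuple d' (appTuple fg.right (c.append d)) → rel k c d') →
      rel (k + 1) (appTuple fg.left c) d) {k : ℕ} (hk : k ≤ N) :
    rel k (posIter fg a N) b := by
  have hS := WTuple.Mono.posSet hfg ha N
  have hle : ∀ {i j}, i ≤ j → WTuple.Le (negSet fg (posSet fg a N) b i)
      (negSet fg (posSet fg a N) b j) := fun h => WTuple.iter_le (fun _ _ => WTuple.le_join_left _ _) h
  -- Each step down in `k` costs one step up in `j`: for `d` in the `j`-th set, the members of `g aₖ
  -- d` lie in the `(j+1)`-st one. The sum `j + k` is kept at most `N`, so the premises, assumed on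
  -- the `N`-th set only, remain applicable.
  have key : ∀ k j, j + k ≤ N → ∀ d, memTuple d (negSet fg (posSet fg a N) b j) →
      rel k (posIter fg a k) d := by
    intro k
    induction k with
    | zero => exact fun j hj d hd => hzero d (memTuple_mono (hle hj) hd)
    | succ k ih =>
      intro j hj d hd
      have hmem := posIter_mem_posSet fg a (show k ≤ N by omega)
      have hmk := WTuple.Mono.posIter hfg ha
      -- The step premise yields the witness `f aₖ`, which lies below `aₖ₊₁ = aₖ ∨ f aₖ`.
      refine hrel _ _ _ _ (WTuple.Mono.appTuple hfg.left (hmk k)) (hmk (k + 1))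
        ((WTuple.Mono.negSet hfg hS hb j).mem hd) (WTuple.le_join_right _ _)
        (hsucc k (by omega) _ d hmem (memTuple_mono (hle (by omega)) hd) fun d' hd' => ?_)
      exact ih (j + 1) (by omega) d' (memTuple_mono (WTuple.le_join_right _ _)
        (memTuple_bigUnionTuple (memTuple_appendStar hmem hd) hd'))
  -- Passing from `aₖ` to `a_N` makes the witness independent of `k`.
  exact hrel _ _ _ _ (WTuple.Mono.posIter hfg ha k) (WTuple.Mono.posIter hfg ha N) hb
    (WTuple.iter_le (fun _ _ => WTuple.le_join_left _ _) hk)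
    (key k 0 (by omega) b (memTuple_singTuple b))

end Induction

/-! ### Interpretability of information relations -/

namespace InfoRel

variable {X Y : Type}

/-- There are witnesses, given by closed witnessing terms, that work for all `x`. -/
def Interpretable (A : InfoRel X) : Prop :=
  ∃ a : WTuple A.pos, Witnessings (Γ := []) (fun _ => a) ∧
    ∀ x b, WTuple.Mono b → A.rel x a b

/-- Change of variables. -/
def comap (A : InfoRel Y) (φ : X → Y) : InfoRel X := ⟨A.pos, A.neg, fun x => A.rel (φ x)⟩

/-- The relation is upward closed in the positive witnesses. -/
def Upward (A : InfoRel X) : Prop :=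
  ∀ x a a' b, WTuple.Mono a → WTuple.Mono a' → WTuple.Mono b → WTuple.Le a a' →
    A.rel x a b → A.rel x a' b

theorem Interpretable.all {A : InfoRel (Y × X)} (h : A.Interpretable) : A.all.Interpretable := by
  obtain ⟨a, ha, hA⟩ := h
  exact ⟨a, ha, fun x b hb y => hA (y, x) b hb⟩

theorem appTuple_left_append_curryTuple {l m k : List WTy} (F : WTuple l → WTuple m)
    (q : WTuple k) (a : WTuple l) : appTuple (Tuple.left ((curryTuple F).append q)) a = F a := by
  rw [Tuple.left_append, appTuple_curryTuple]

/-- Modus ponens at a given pair of negative witnesses, with the projections of the concatenated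
tuple already computed. -/
theorem imp_rel_append {A B : InfoRel X} {x : X} {fg : WTuple (A.imp B).pos} {a : WTuple A.pos}
    {d : WTuple B.neg} (h : (A.imp B).rel x fg (Tuple.append a d))
    (hA : ∀ b, memTuple b (appTuple (Tuple.right fg) (Tuple.append a d)) → A.rel x a b) :
    B.rel x (appTuple (Tuple.left fg) a) d := by
  have h' := h fun b hb => by
    rw [Tuple.left_append]
    exact hA b hb
  rwa [Tuple.left_append, Tuple.right_append] at h'

/-- Reduces an implication to its mathematical content: a map `F` on positive witnesses and a map
`G` giving the finite sets of counterexamples to test. Currying into tuples of functionals is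
packaging. -/
theorem Interpretable.imp_intro {A B : InfoRel X} {F : WTuple A.pos → WTuple B.pos}
    {G : WTuple A.pos → WTuple B.neg → WTuple (A.neg.map WTy.star)} (hF : Witnessings F)
    (hG : Witnessings (Γ := A.pos ++ B.neg) fun u => G u.left u.right)
    (h : ∀ x a d, WTuple.Mono a → WTuple.Mono d →
      (∀ b, memTuple b (G a d) → A.rel x a b) → B.rel x (F a) d) :
    (A.imp B).Interpretable := by
  refine ⟨(curryTuple F).append (curryTuple (l := A.pos ++ B.neg) fun u => G u.left u.right),
    ?_, ?_⟩
  · exact (Witnessings.curryTuple (F := fun a _ => F a) (hF.comp .left)).append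
      (Witnessings.curryTuple (F := fun u _ => G u.left u.right)
        (hG.comp (Γ := A.pos ++ B.neg) .left))
  · rintro x (ad : WTuple (A.pos ++ B.neg)) had hA
    rw [Tuple.left_append, appTuple_curryTuple]
    refine h x _ _ (Tuple.All.left had) (Tuple.All.right had) fun b hb => hA b ?_
    have e := appTuple_curryTuple (fun u : WTuple (A.pos ++ B.neg) => G u.left u.right) ad
    rw [Tuple.right_append]
    exact e.symm ▸ hb

theorem Interpretable.imp_const {A B : InfoRel X} (h : B.Interpretable) :
    (A.imp B).Interpretable := by
  obtain ⟨a, ha, hB⟩ := h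
  -- Nothing is asked of the premise, but the star types contain only non-empty sets, so default
  -- elements fill the negative part.
  exact Interpretable.imp_intro (F := fun _ => a) (G := fun _ _ => WTuple.zero _)
    (ha.comp (Γ := []) (G := fun _ => ()) trivial) .zero fun x _ d _ hd _ => hB x d hd

theorem interpretable_witnessFree {P : X → Prop} (h : ∀ x, P x) :
    (witnessFree P).Interpretable :=
  ⟨(), trivial, fun x _ _ => h x⟩

theorem imp_witnessFree (P Q : X → Prop) :
    (witnessFree P).imp (witnessFree Q) = witnessFree fun x => P x → Q x := by
  have : ∀ x, (∀ _ : Unit, True → P x) ↔ P x := fun x => ⟨fun h => h () trivial, fun h _ _ => h⟩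
  refine congrArg (InfoRel.mk [] []) ?_
  funext x _ _
  exact congrArg (· → Q x) (propext (this x))

/-- A larger `g` tests more counterexamples, which only strengthens the premise, and a larger `f a`
is absorbed by the upward closure of `B`. -/
theorem Upward.imp {A B : InfoRel X} (hB : B.Upward) : (A.imp B).Upward := by
  intro x fg fg' ad hfg hfg' had hle h hA
  have hl : ∀ {l m : List WTy} {f f' : WTuple (m.map (WTy.arrs l))} (a : WTuple l),
      WTuple.Le f f' → WTuple.Le (appTuple f a) (appTuple f' a) := by
    intro l m f f' a hff'
    have hone : ∀ {l : List WTy} {τ : WTy} {f f' : (WTy.arrs l τ).Interp} (a : WTuple l),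
        WTy.Le _ f f' → WTy.Le _ (applyAll f a) (applyAll f' a) := by
      intro l τ f f' a h
      induction l with
      | nil => exact h
      | cons ρ l ih => exact ih a.2 (h a.1)
    induction m with
    | nil => trivial
    | cons ρ m ih => exact ⟨hone a hff'.1, ih hff'.2⟩
  refine hB x _ _ _ (WTuple.Mono.appTuple (Tuple.All.left hfg) (Tuple.All.left had))
    (WTuple.Mono.appTuple (Tuple.All.left hfg') (Tuple.All.left had)) (Tuple.All.right had)
    (hl _ (Tuple.Rel.left hle)) (h fun b hb => hA b ?_)
  exact memTuple_mono (hl ad (Tuple.Rel.right hle)) hb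

theorem Upward.and {A B : InfoRel X} (hA : A.Upward) (hB : B.Upward) : (A.and B).Upward :=
  fun x _ _ _ ha ha' hb hle h =>
    ⟨hA x _ _ _ (Tuple.All.left ha) (Tuple.All.left ha') (Tuple.All.left hb) (Tuple.Rel.left hle) h.1,
      hB x _ _ _ (Tuple.All.right ha) (Tuple.All.right ha') (Tuple.All.right hb)
        (Tuple.Rel.right hle) h.2⟩

theorem Upward.all {A : InfoRel (Y × X)} (hA : A.Upward) : A.all.Upward :=
  fun x _ _ _ ha ha' hb hle h y => hA (y, x) _ _ _ ha ha' hb hle (h y)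

theorem Upward.ex {A : InfoRel (Y × X)} (hA : A.Upward) : A.ex.Upward := by
  rintro x a a' B ha ha' hB hle ⟨y, h⟩
  exact ⟨y, fun b hb => hA (y, x) _ _ _ ha ha' (WTuple.Mono.mem hB hb) hle (h b hb)⟩

/-- Case distinction on a Boolean. -/
theorem interpretable_bool_elim {U : InfoRel (Fin 2 × X)} (hU : U.Upward) (P : Fin 2 × X → Prop) :
    (((U.comap fun x => (0, x)).and (U.comap fun x => (1, x))).imp
      ((witnessFree P).imp U).all).Interpretable := by
  -- The Boolean carries no witness, so the answer cannot depend on it: the join of the two given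
  -- witnesses serves both cases, and both premises are tested at the same `d`.
  refine Interpretable.imp_intro
    (F := fun u : WTuple (U.pos ++ U.pos) => Tuple.append (m := [])
      (curryTuple (l := []) (m := U.pos) fun _ => WTuple.join u.left u.right) ())
    (G := fun _ (d : WTuple U.neg) => appendStar (singTuple d) (singTuple d)) ?_ ?_ ?_
  · exact Witnessings.append (m := []) (Witnessings.curryTuple (l := [])
      (F := fun _ u => WTuple.join (Tuple.left u) (Tuple.right u))
      (Witnessings.left.join Witnessings.right)) trivial
  · have hr := Witnessings.right (l := U.pos ++ U.pos) (m := U.neg)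
    exact hr.singTuple.appendStar hr.singTuple
  · rintro x (a : WTuple (U.pos ++ U.pos)) (d : WTuple U.neg) ha hd h y -
    have ha0 : WTuple.Mono (Tuple.left a) := Tuple.All.left ha
    have ha1 : WTuple.Mono (Tuple.right a) := Tuple.All.right ha
    have h' := h (d.append d) (memTuple_appendStar (memTuple_singTuple d) (memTuple_singTuple d))
    have h0 : U.rel (0, x) (Tuple.left a) d :=
      (congrArg (U.rel (0, x) (Tuple.left a)) (Tuple.left_append d d)).mp h'.1
    have h1 : U.rel (1, x) (Tuple.right a) d :=
      (congrArg (U.rel (1, x) (Tuple.right a)) (Tuple.right_append d d)).mp h'.2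
    refine (congrArg (fun c => U.rel (y, x) c d) (appTuple_left_append_curryTuple (l := []) (k := [])
      (fun _ => WTuple.join (Tuple.left a) (Tuple.right a)) () ())).mpr ?_
    match y with
    | 0 => exact hU _ _ _ _ ha0 (ha0.join ha1) hd (WTuple.le_join_left _ _) h0
    | 1 => exact hU _ _ _ _ ha1 (ha0.join ha1) hd (WTuple.le_join_right _ _) h1

/-- The interpretation of `I_ℕ(x)`. -/
def natInfo : InfoRel (ℕ × X) := ⟨[.nat], [], fun x a _ => x.1 ≤ a.1⟩

/-- Induction. -/
theorem interpretable_induction {U : InfoRel (ℕ × X)} (hU : U.Upward) :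
    (((U.comap fun x => (0, x)).and
      (natInfo.imp (U.imp (U.comap fun x => (x.1 + 1, x.2)))).all).imp
        (natInfo.imp U).all).Interpretable := by
  -- `Q` lists the positive witness types of the step premise: functions of a bound for the number
  -- `k`. The trailing empty list comes from `I_ℕ`, which has no negative witnesses.
  let Q : List WTy := (stepTypes U.pos U.neg).map (WTy.arrs [.nat]) ++ []
  -- The step functionals are taken at the bound `N`, which witnesses `I_ℕ(k)` for all `k ≤ N`
  -- simultaneously.
  let fg : WTuple (U.pos ++ Q) → ℕ → WTuple (stepTypes U.pos U.neg) := fun u N =>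
    appTuple (l := [.nat]) (Tuple.left (l := (stepTypes U.pos U.neg).map (WTy.arrs [.nat])) (m := [])
      (u.right (l := U.pos))) (N, ())
  let C : WTuple (U.pos ++ Q) → ℕ → WTuple (U.pos.map WTy.star) := fun u N =>
    posSet (fg u N) u.left N
  let B : WTuple (U.pos ++ Q) → WTuple (.nat :: U.neg) → WTuple (U.neg.map WTy.star) := fun u d =>
    negSet (fg u d.1) (C u d.1) d.2 d.1
  have hfg : ∀ {Γ : List WTy} {u : WTuple Γ → WTuple (U.pos ++ Q)} {N : WTuple Γ → ℕ},
      Witnessings u → Witnessing (ρ := .nat) N → Witnessings fun e => fg (u e) (N e) :=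
    fun {Γ u N} hu hN => Witnessings.appTuple (l := [.nat])
      ((Witnessings.left (l := (stepTypes U.pos U.neg).map (WTy.arrs [.nat])) (m := [])).comp
        (Witnessings.right.comp hu)) (G := fun e => (N e, ())) ⟨hN, trivial⟩
  refine Interpretable.imp_intro
    (F := fun u : WTuple (U.pos ++ Q) => Tuple.append (m := [])
      (curryTuple (l := [.nat]) (m := U.pos) fun N => posIter (fg u N.1) u.left N.1) ())
    -- Base premise: all of `B`. Step premise: the single bound `N`, all iterates in `C`, and all of
    -- `B`.
    (G := fun u (d : WTuple (.nat :: U.neg)) =>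
      appendStar (l := U.neg) (m := .nat :: (U.pos ++ U.neg)) (B u d)
        ((WConst.sing .nat).eval d.1, appendStar (C u d.1) (B u d))) ?_ ?_ ?_
  · exact Witnessings.append (m := []) (Witnessings.curryTuple (l := [.nat])
      (F := fun N u => posIter (fg u N.1) u.left N.1)
      (Witnessings.posIter (hfg (Witnessings.id (m := U.pos ++ Q)).weaken .head)
        (Witnessings.left.weaken) .head)) trivial
  · have hu := Witnessings.left (l := U.pos ++ Q) (m := .nat :: U.neg)
    have hd := Witnessings.right (l := U.pos ++ Q) (m := .nat :: U.neg)
    have hC := (hfg hu hd.1).posSet (Witnessings.left.comp hu) hd.1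
    have hB := (hfg hu hd.1).negSet hC hd.2 hd.1
    exact Witnessings.appendStar (m := .nat :: (U.pos ++ U.neg)) hB
      ⟨hd.1.sing, hC.appendStar hB⟩
  · rintro x (u : WTuple (U.pos ++ Q)) (Nd : WTuple (.nat :: U.neg)) hu hNd h k hk
    obtain ⟨N, d⟩ := Nd
    change ℕ at N
    change WTuple U.neg at d
    have hd : WTuple.Mono d := hNd.2
    have hk' : k ≤ N := hk () trivial
    have hu0 : WTuple.Mono (Tuple.left u) := Tuple.All.left hu
    have hmem : ∀ c d', memTuple c (C u N) → memTuple d' (B u (N, d)) →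
        memTuple (Tuple.append (m := .nat :: (U.pos ++ U.neg)) d' (N, Tuple.append c d'))
          (appendStar (l := U.neg) (m := .nat :: (U.pos ++ U.neg)) (B u (N, d))
            ((WConst.sing .nat).eval N, appendStar (C u N) (B u (N, d)))) := fun c d' hc hd' =>
      memTuple_appendStar (m := .nat :: (U.pos ++ U.neg)) hd' ⟨rfl, memTuple_appendStar hc hd'⟩
    refine (congrArg (fun c => U.rel (k, x) c d) (appTuple_left_append_curryTuple
      (l := [.nat]) (k := []) (fun N => posIter (fg u N.1) (Tuple.left u) N.1) () (N, ()))).mpr ?_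
    have hmfg : WTuple.Mono (fg u N) := WTuple.Mono.appTuple (l := [.nat])
      (Tuple.All.left (m := []) (Tuple.All.right hu)) ⟨Nat.le_refl N, trivial⟩
    refine rel_posIter (rel := fun k => U.rel (k, x)) (fun k => hU (k, x)) hmfg hu0 hd ?_ ?_ hk'
    · intro d' hd'
      have h' := (h _ (hmem _ d' (posIter_mem_posSet (fg u N) (Tuple.left u) (Nat.zero_le N)) hd')).1
      exact (congrArg (U.rel (0, x) (Tuple.left u)) (Tuple.left_append _ _)).mp h'
    · intro k hk c d' hc hd' hrel
      have h' := (h _ (hmem c d' hc hd')).2 k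
      have h'' := (congrArg ((natInfo.imp (U.imp (U.comap fun x => (x.1 + 1, x.2)))).rel (k, x)
        (Tuple.right u)) (Tuple.right_append (m := .nat :: (U.pos ++ U.neg)) _ _)).mp h'
      exact imp_rel_append (B := U.comap fun x => (x.1 + 1, x.2)) (x := (k, x))
        (h'' fun _ _ => hk) hrel

end InfoRel

/-! ### The interpretation of formulas -/

theorem uInterpretable_iff {Γ : List Ty} {A : IForm Γ} :
    Imb.UInterpretable A ↔ (Imb.uInter A).Interpretable := by
  constructor
  · rintro ⟨t, ht, h⟩
    exact ⟨_, Witnessings.of_term t ht, h⟩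
  · rintro ⟨a, ha, h⟩
    obtain ⟨t, rfl⟩ := ha.exists_term
    exact ⟨t, ha.mono (e := ()) trivial, h⟩

theorem interpretable_close : ∀ {Γ : List Ty} {A : IForm Γ}, (Imb.uInter A).Interpretable →
    (Imb.uInter A.close).Interpretable
  | [], _, h => h
  | _ :: _, A, h => interpretable_close (A := .all _ A) h.all

/-- Witnesses that work for all parameter values can ignore the bounds supplied by the guards. -/
theorem interpretable_guardedClosure {Γ : List Ty} {A : Form Γ}
    (h : (Imb.uInter A.relativize).Interpretable) : Imb.IInterpretable A := by
  refine uInterpretable_iff.2 (interpretable_close ?_)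
  cases allVars Γ with
  | nil => exact h
  | cons v l => exact h.imp_const

theorem arrMaj_of_monotone {X Y : Type} {s t : WTy} {Q : X → WTuple [s] → Prop}
    {R : Y → WTuple [t] → Prop} {f : X → Y} {g : (s ⇾ t).Interp} (hg : (s ⇾ t).Monotone g)
    (h : ∀ x a, Q x (a, ()) → R (f x) (g a, ())) :
    arrMaj (some s) (some t) Q R f (g, ()) :=
  ⟨h, fun z a hza => (hg z a hza).1⟩

theorem arrMaj_mono {X Y : Type} : ∀ {s t : Option WTy} {Q : X → WTuple s.toList → Prop}
    {R : Y → WTuple t.toList → Prop} {f : X → Y} {g : WTuple (arrDagger s t).toList},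
    arrMaj s t Q R f g → WTuple.Mono g
  | some _, some _, _, _, _, _, h => ⟨WTy.monotone_arr_iff.2 h.2, trivial⟩
  | none, some _, _, _, _, _, h => ⟨h.2, trivial⟩
  | some _, none, _, _, _, _, _ => trivial
  | none, none, _, _, _, _, _ => trivial

/-- The majorant `a` of an argument must be monotone, so that `g ≤ g'` can be evaluated at `a ≤ a`.
-/
theorem arrMaj_trans {X Y : Type} : ∀ {s t : Option WTy} {Q : X → WTuple s.toList → Prop}
    {R : Y → WTuple t.toList → Prop} {f : X → Y} {g g' : WTuple (arrDagger s t).toList},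
    (∀ x a, Q x a → WTuple.Mono a) → (∀ y a a', R y a → WTuple.Maj a a' → R y a') →
    arrMaj s t Q R f g → WTuple.Maj g g' → arrMaj s t Q R f g'
  | some _, some _, _, _, _, _, _, hQ, hR, h, h' =>
      ⟨fun x a hx => hR _ _ _ (h.1 x a hx) ⟨(h'.1 a a (hQ x _ hx).1).1, trivial⟩,
        fun z a hza => (h'.1 z a hza).2⟩
  | none, some _, _, _, _, _, _, _, hR, h, h' => ⟨fun x => hR _ _ _ (h.1 x) h', h'.1.right⟩
  | some _, none, _, _, _, _, _, _, _, _, _ => trivial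
  | none, none, _, _, _, _, _, _, _, _, _ => trivial

theorem Ty.Maj.mono : ∀ {σ : Ty} {x : σ.Interp} {a : WTuple σ.dagger.toList}, σ.Maj x a →
    WTuple.Mono a
  | .nat, _, _, _ => ⟨Nat.le_refl _, trivial⟩
  | .bool, _, _, _ => trivial
  | .arr _ _, _, _, h => arrMaj_mono h

theorem Ty.Maj.trans : ∀ {σ : Ty} {x : σ.Interp} {a a' : WTuple σ.dagger.toList}, σ.Maj x a →
    WTuple.Maj a a' → σ.Maj x a'
  | .nat, _, _, _, h, h' => Nat.le_trans h h'.1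
  | .bool, _, _, _, _, _ => trivial
  | .arr _ _, _, _, _, h, h' =>
      arrMaj_trans (fun _ _ => Ty.Maj.mono) (fun _ _ _ => Ty.Maj.trans) h h'

/-- Among the atoms, only `I_σ` has witnesses; there the claim is transitivity of majorizability. -/
theorem upward_uInter : ∀ {Γ : List Ty} (A : IForm Γ), (Imb.uInter A).Upward
  | _, .eq _ _ => fun _ _ _ _ _ _ _ _ h => h
  | _, .info _ => fun _ _ _ _ ha ha' _ hle h => Ty.Maj.trans h (hle.maj ha ha')
  | _, .bot => fun _ _ _ _ _ _ _ _ h => h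
  | _, .and A B => (upward_uInter A).and (upward_uInter B)
  | _, .imp _ B => (upward_uInter B).imp
  | _, .all _ A => (upward_uInter A).all
  | _, .ex _ A => (upward_uInter A).ex

/-! ### Substitution -/

/-- The values of the terms that are substituted. -/
def substEnv {Δ : List Ty} : {Γ : List Ty} → (∀ σ, Var Γ σ → Tm Δ σ) → Env Δ → Env Γ
  | [], _, _ => ()
  | _ :: _, s, e => ((s _ .zero).eval e, substEnv (fun σ v => s σ (.succ v)) e)

theorem eval_substEnv : ∀ {Γ Δ : List Ty} {σ : Ty} (s : ∀ σ, Var Γ σ → Tm Δ σ) (v : Var Γ σ)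
    (e : Env Δ), v.eval (substEnv s e) = (s σ v).eval e
  | _, _, _, _, .zero, _ => rfl
  | _, _, _, s, .succ v, e => eval_substEnv (fun σ w => s σ (.succ w)) v e

theorem Tm.eval_subst {Γ Δ : List Ty} (s : ∀ σ, Var Γ σ → Tm Δ σ) (e : Env Δ) :
    ∀ {σ : Ty} (t : Tm Γ σ), (t.subst s).eval e = t.eval (substEnv s e)
  | _, .var v => (eval_substEnv s v e).symm
  | _, .const _ => rfl
  | _, .app t u => by simp only [Tm.subst, Tm.eval, Tm.eval_subst s e t, Tm.eval_subst s e u]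

theorem Tm.eval_rename_succ {Γ : List Ty} {τ : Ty} (y : τ.Interp) (e : Env Γ) :
    ∀ {σ : Ty} (t : Tm Γ σ), (t.rename fun _ w => .succ (τ := τ) w).eval (y, e) = t.eval e
  | _, .var _ => rfl
  | _, .const _ => rfl
  | _, .app t u => by
    simp only [Tm.rename, Tm.eval, Tm.eval_rename_succ y e t, Tm.eval_rename_succ y e u]

theorem substEnv_congr {Δ Δ' : List Ty} {e : Env Δ} {e' : Env Δ'} : ∀ {Γ : List Ty}
    {s : ∀ σ, Var Γ σ → Tm Δ σ} {s' : ∀ σ, Var Γ σ → Tm Δ' σ},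
    (∀ σ v, (s σ v).eval e = (s' σ v).eval e') → substEnv s e = substEnv s' e'
  | [], _, _, _ => rfl
  | _ :: _, _, _, h => Prod.ext (h _ _) (substEnv_congr fun σ v => h σ (.succ v))

theorem substEnv_liftSubst {Γ Δ : List Ty} {τ : Ty} (s : ∀ σ, Var Γ σ → Tm Δ σ) (y : τ.Interp)
    (e : Env Δ) : substEnv (liftSubst (τ := τ) s) (y, e) = (y, substEnv s e) :=
  Prod.ext rfl (substEnv_congr fun _ _ => Tm.eval_rename_succ y e _)

theorem substEnv_var : ∀ {Γ : List Ty} (e : Env Γ), substEnv (fun _ v => .var v) e = e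
  | [], _ => rfl
  | _ :: _, e => by
    have h : substEnv (fun _ v => .var (.succ v)) e = substEnv (fun _ v => .var v) e.2 :=
      substEnv_congr fun _ _ => rfl
    exact Prod.ext rfl (h.trans (substEnv_var e.2))

theorem substEnv_instSubst {Γ : List Ty} {τ : Ty} (t : Tm Γ τ) (e : Env Γ) :
    substEnv (instSubst t) e = (t.eval e, e) :=
  Prod.ext rfl (substEnv_var e)

theorem substEnv_succSubst {Γ : List Ty} (e : Env (.nat :: Γ)) :
    substEnv succSubst e = ((e.1 : ℕ) + 1, e.2) :=
  have h := congrArg Prod.snd (substEnv_var e)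
  Prod.ext rfl h

/-- An equality of information relations, and not a mere equivalence, so the witness types agree and
it can be used for rewriting. Under a binder, the guard concerns the bound variable alone, which the
lifted substitution fixes. -/
theorem uInter_relativize_subst : ∀ {Γ Δ : List Ty} (s : ∀ σ, Var Γ σ → Tm Δ σ) (A : Form Γ),
    Imb.uInter (A.subst s).relativize = (Imb.uInter A.relativize).comap (substEnv s)
  | _, _, s, .eq t u => by
    refine congrArg (InfoRel.mk [] []) (funext fun e => ?_)
    exact congrArg₂ (fun a b => fun (_ _ : WTuple []) => a = b) (Tm.eval_subst s e t)
      (Tm.eval_subst s e u)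
  | _, _, _, .bot => rfl
  | _, _, s, .and A B =>
    congrArg₂ InfoRel.and (uInter_relativize_subst s A) (uInter_relativize_subst s B)
  | _, _, s, .imp A B =>
    congrArg₂ InfoRel.imp (uInter_relativize_subst s A) (uInter_relativize_subst s B)
  | Γ, Δ, s, .all σ A => by
    have h := uInter_relativize_subst (liftSubst (τ := σ) s) A
    have h' : substEnv (liftSubst (τ := σ) s) = fun e : Env (σ :: Δ) => (e.1, substEnv s e.2) :=
      funext fun e => substEnv_liftSubst s e.1 e.2
    rw [h'] at h
    exact congrArg (fun U => InfoRel.all (Y := σ.Interp) (X := Env Δ)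
      (InfoRel.imp (Imb.uInter (.info (.var .zero))) U)) h
  | Γ, Δ, s, .ex σ A => by
    have h := uInter_relativize_subst (liftSubst (τ := σ) s) A
    have h' : substEnv (liftSubst (τ := σ) s) = fun e : Env (σ :: Δ) => (e.1, substEnv s e.2) :=
      funext fun e => substEnv_liftSubst s e.1 e.2
    rw [h'] at h
    exact congrArg (fun U => InfoRel.ex (Y := σ.Interp) (X := Env Δ)
      (InfoRel.and (Imb.uInter (.info (.var .zero))) U)) h

theorem uInter_relativize_inst {Γ : List Ty} {τ : Ty} (A : Form (τ :: Γ)) (t : Tm Γ τ) :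
    Imb.uInter (A.inst t).relativize =
      (Imb.uInter A.relativize).comap fun e => (t.eval e, e) := by
  rw [Form.inst, uInter_relativize_subst]
  exact congrArg _ (funext (substEnv_instSubst t))

/-! ### The axioms -/

theorem Form.QuantifierFree.exists_witnessFree : ∀ {Γ : List Ty} {A : Form Γ},
    A.QuantifierFree → ∃ P : Env Γ → Prop, Imb.uInter A.relativize = InfoRel.witnessFree P
  | _, .eq _ _, _ => ⟨_, rfl⟩
  | _, .bot, _ => ⟨_, rfl⟩
  | _, .and A B, h => by
    obtain ⟨P, hP⟩ := exists_witnessFree (A := A) h.1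
    obtain ⟨Q, hQ⟩ := exists_witnessFree (A := B) h.2
    exact ⟨fun e => P e ∧ Q e, congrArg₂ InfoRel.and hP hQ⟩
  | _, .imp A B, h => by
    obtain ⟨P, hP⟩ := exists_witnessFree (A := A) h.1
    obtain ⟨Q, hQ⟩ := exists_witnessFree (A := B) h.2
    exact ⟨fun e => P e → Q e, (congrArg₂ InfoRel.imp hP hQ).trans (InfoRel.imp_witnessFree P Q)⟩

theorem interpretable_eq {Γ : List Ty} {σ : Ty} {t u : Tm Γ σ} (h : ∀ e, t.eval e = u.eval e) :
    (Imb.uInter (.eq t u)).Interpretable :=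
  InfoRel.interpretable_witnessFree h

theorem interpretable_eq_subst {Γ : List Ty} {σ : Ty} {C : Form (σ :: σ :: σ :: Γ)}
    (hC : C.QuantifierFree) :
    (Imb.uInter (Form.imp
        (.and (C.inst (.var (.succ .zero))) (.eq (.var (.succ .zero)) (.var .zero)))
        (C.inst (.var .zero))).relativize).Interpretable := by
  obtain ⟨P, hP⟩ := hC.exists_witnessFree
  have h1 := uInter_relativize_inst C (.var (.succ .zero))
  have h2 := uInter_relativize_inst C (.var .zero)
  rw [hP] at h1 h2
  change ((InfoRel.and (Imb.uInter (C.inst _).relativize) (.witnessFree fun e => _ = _)).imp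
    (Imb.uInter (C.inst _).relativize)).Interpretable
  rw [h1, h2]
  refine ⟨(), trivial, fun e _ _ h => ?_⟩
  obtain ⟨h, h'⟩ := h () trivial
  change (Tm.var (.succ .zero)).eval e = (Tm.var Var.zero).eval e at h'
  change P ((Tm.var Var.zero).eval e, e)
  rw [← h']
  exact h

theorem interpretable_of_ax {Γ : List Ty} {A : Form Γ} (h : Ax A) :
    (Imb.uInter A.relativize).Interpretable := by
  cases h with
  | eq_refl σ => exact .all (.imp_const (interpretable_eq fun _ => rfl))
  | eq_subst σ C hC => exact .all (.imp_const (.all (.imp_const (interpretable_eq_subst hC))))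
  | pi ρ σ => exact interpretable_eq fun _ => rfl
  | sig ρ σ γ => exact interpretable_eq fun _ => rfl
  | bool_ne => exact ⟨(), trivial, fun _ _ _ h => absurd (h () trivial) (show (0 : Fin 2) ≠ 1 by decide)⟩
  | bool_elim D =>
    -- The type of Booleans is bounded, so its guard is interpreted as truth.
    have h := InfoRel.interpretable_bool_elim (upward_uInter D.relativize) fun _ => True
    have h0 := uInter_relativize_inst D (.const .bool0)
    have h1 := uInter_relativize_inst D (.const .bool1)
    exact (congrArg₂ (fun U V => ((InfoRel.and U V).imp
      (Imb.uInter (Form.all .bool D).relativize)).Interpretable) h0 h1).mpr h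
  | cond_zero σ => exact interpretable_eq fun _ => rfl
  | cond_one σ => exact interpretable_eq fun _ => rfl
  | succ_inj => exact ⟨(), trivial, fun _ _ _ h => Nat.succ.inj (h () trivial)⟩
  | succ_ne_zero => exact ⟨(), trivial, fun _ _ _ h => absurd (h () trivial) (Nat.succ_ne_zero _)⟩
  | recur_zero σ => exact interpretable_eq fun _ => rfl
  | recur_succ σ => exact interpretable_eq fun _ => rfl
  | @induction Γ A =>
    have h := InfoRel.interpretable_induction (upward_uInter A.relativize)
    have h0 := uInter_relativize_inst A (.const .zero)
    have h1 := uInter_relativize_subst succSubst A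
    rw [show substEnv (succSubst (Γ := Γ)) = fun e : Env (.nat :: Γ) => ((e.1 : ℕ) + 1, e.2) from
      funext substEnv_succSubst] at h1
    exact (congrArg₂ (fun (U : InfoRel (Env Γ)) (V : InfoRel (Env (.nat :: Γ))) => ((U.and
      (InfoRel.all (Y := ℕ) (X := Env Γ)
        (InfoRel.natInfo.imp ((Imb.uInter A.relativize).imp V)))).imp
      (Imb.uInter (Form.all .nat A).relativize)).Interpretable) h0 h1).mpr h

/-! ### The constants and application -/

theorem Witnessing.monotone {ρ : WTy} {x : ρ.Interp} (h : Witnessing (Γ := []) fun _ => x) :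
    ρ.Monotone x :=
  h.maj () () trivial

/-- `x` is majorized by (the value of) a closed witnessing term. -/
def Ty.Majorizable (σ : Ty) (x : σ.Interp) : Prop :=
  ∃ a : WTuple σ.dagger.toList, Witnessings (Γ := []) (fun _ => a) ∧ σ.Maj x a

/-- Only the emptiness of the types `σ†` matters, so these and the relations are generalized before
the case distinction. When the second argument is bounded, erasing it turns `λ x y. x` into the
identity. -/
theorem majorizable_pi (ρ σ : Ty) : Ty.Majorizable _ (Const.pi ρ σ).eval := by
  unfold Ty.Majorizable
  simp only [Ty.Maj, Ty.dagger]
  have hm := @Ty.Maj.mono ρ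
  generalize Ty.Maj ρ = R at *
  generalize Ty.Maj σ = S at *
  generalize ρ.dagger = r at *
  generalize σ.dagger = s at *
  match r, s with
  | none, none | none, some _ => exact ⟨(), trivial, trivial⟩
  | some r, none =>
    have h : Witnessing (Γ := []) (ρ := r ⇾ r) fun _ x => x := .lam .head
    exact ⟨_, ⟨h, trivial⟩, arrMaj_of_monotone h.monotone fun x a hx => ⟨fun _ => hx, (hm hx).1⟩⟩
  | some r, some s =>
    have h : Witnessing (Γ := []) (ρ := r ⇾ s ⇾ r) fun _ x _ => x := .lam (.lam (.weaken .head))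
    exact ⟨_, ⟨h, trivial⟩, arrMaj_of_monotone h.monotone fun x a hx =>
      arrMaj_of_monotone (h.monotone.app (hm hx).1) fun _ _ _ => hx⟩

/-- If `σ` or `γ` is bounded, erasing its arguments leaves the identity at a suitable type; `Σ`
itself is needed only when all three types are unbounded. -/
theorem majorizable_sig (ρ σ γ : Ty) : Ty.Majorizable _ (Const.sig ρ σ γ).eval := by
  unfold Ty.Majorizable
  simp only [Ty.Maj, Ty.dagger]
  generalize Ty.Maj ρ = R
  generalize Ty.Maj σ = S
  generalize Ty.Maj γ = G
  generalize ρ.dagger = r at *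
  generalize σ.dagger = s at *
  generalize γ.dagger = g at *
  match r, s, g with
  | none, none, none | none, none, some _ | none, some _, none | none, some _, some _ =>
    exact ⟨(), trivial, trivial⟩
  | some r, none, none =>
    have h : Witnessing (Γ := []) (ρ := r ⇾ r) fun _ x => x := .lam .head
    exact ⟨_, ⟨h, trivial⟩, arrMaj_of_monotone h.monotone fun x a hx =>
      ⟨fun y => ⟨fun z => (hx.1 z).1 (y z), hx.2⟩, hx.2⟩⟩
  | some r, none, some g =>
    have h : Witnessing (Γ := []) (ρ := (g ⇾ r) ⇾ g ⇾ r) fun _ x => x := .lam .head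
    exact ⟨_, ⟨h, trivial⟩, arrMaj_of_monotone h.monotone fun x a hx =>
      have ha : (g ⇾ r).Monotone a := WTy.monotone_arr_iff.2 hx.2
      ⟨fun y => arrMaj_of_monotone ha fun z c hz => (hx.1 z c hz).1 (y z), ha⟩⟩
  | some r, some s, none =>
    have h : Witnessing (Γ := []) (ρ := (s ⇾ r) ⇾ s ⇾ r) fun _ x => x := .lam .head
    exact ⟨_, ⟨h, trivial⟩, arrMaj_of_monotone h.monotone fun x a hx =>
      arrMaj_of_monotone hx.2 fun y b hy =>
        ⟨fun z => (hx.1 z).1 _ _ (hy.1 z), WTy.Monotone.app (ρ := s) (τ := r) hx.2 hy.2⟩⟩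
  | some r, some s, some g =>
    have h : Witnessing (Γ := []) fun _ => (WConst.sig r s g).eval :=
      .const (WConst.monotone_sig r s g)
    exact ⟨_, ⟨h, trivial⟩, arrMaj_of_monotone h.monotone fun x a hx =>
      have ha := h.monotone.app (WTy.monotone_arr_iff.2 hx.2)
      arrMaj_of_monotone ha fun y b hy =>
        arrMaj_of_monotone (ha.app (WTy.monotone_arr_iff.2 hy.2)) fun z c hz =>
          (hx.1 z c hz).1 _ _ (hy.1 z c hz)⟩

/-- The Boolean argument is erased, so the majorant must cover both branches: it is their join. -/
theorem majorizable_cond (σ : Ty) : Ty.Majorizable _ (Const.cond σ).eval := by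
  unfold Ty.Majorizable
  simp only [Ty.Maj, Ty.dagger]
  have hm := @Ty.Maj.mono σ
  have ht := @Ty.Maj.trans σ
  generalize Ty.Maj σ = S at *
  generalize σ.dagger = s at *
  match s with
  | none => exact ⟨(), trivial, trivial⟩
  | some s =>
    have h : Witnessing (Γ := []) (ρ := s ⇾ s ⇾ s) fun _ x y => s.join x y :=
      .lam (.lam (.join (.weaken .head) .head))
    refine ⟨(fun x y => s.join x y, ()), ⟨h, trivial⟩, fun i => arrMaj_of_monotone h.monotone fun x a hx =>
      arrMaj_of_monotone (h.monotone.app (hm hx).1) fun y b hy => ?_, h.monotone⟩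
    have ha := (hm hx).1
    have hb := (hm hy).1
    match i with
    | 0 => exact ht hx ⟨(WTy.le_join_left a b).maj ha (ha.join hb), trivial⟩
    | 1 => exact ht hy ⟨(WTy.le_join_right a b).maj hb (ha.join hb), trivial⟩

/-- The majorant iterates `r ↦ r ∨ f k r`: the join restores monotonicity in the number argument,
and its right half still majorizes the original step. -/
theorem majorizable_recur (σ : Ty) : Ty.Majorizable _ (Const.recur σ).eval := by
  unfold Ty.Majorizable
  simp only [Ty.Maj, Ty.dagger]
  have hm := @Ty.Maj.mono σ
  have ht := @Ty.Maj.trans σ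
  generalize Ty.Maj σ = S at *
  generalize σ.dagger = s at *
  match s with
  | none => exact ⟨(), trivial, trivial⟩
  | some s =>
    let τ : WTy := .nat ⇾ s ⇾ s
    have hstep : Witnessing (Γ := [s, .nat, τ, s]) (ρ := s)
        fun u => s.join u.1 (u.2.2.1 u.2.1 u.1) :=
      .join .head (.app (.app (.weaken (.weaken .head)) (.weaken .head)) .head)
    have hrec := Witnessing.natRec (Γ := [τ, s]) (ρ := s) (W := fun e => e.2.1)
      (S := fun u => s.join u.1 (u.2.2.1 u.2.1 u.1)) (.weaken .head) hstep
      fun e k x he hx => (WTy.le_join_left _ _).maj hx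
        (hx.join ((he.1.app (Nat.le_refl k)).app hx))
    have h : Witnessing (Γ := []) (ρ := .nat ⇾ s ⇾ τ ⇾ s) fun _ n w f =>
        Nat.rec (motive := fun _ => s.Interp) w (fun k r => s.join r (f k r)) n := by
      have h' := hrec.comp (Γ := [.nat, τ, s]) (Δ := [τ, s, .nat]) (G := fun u => (u.2.2.1, u.1, u.2.1, ()))
        ⟨.weaken (.weaken .head), .head, .weaken .head, trivial⟩
      exact .lam (.lam (.lam h'))
    refine ⟨_, ⟨h, trivial⟩, arrMaj_of_monotone h.monotone fun n N hn => ?_⟩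
    have h1 := h.monotone.app (Nat.le_refl N)
    refine arrMaj_of_monotone h1 fun x a hx => ?_
    have h2 := h1.app (hm hx).1
    refine arrMaj_of_monotone h2 fun f b hf => ?_
    have hb : τ.Monotone b := WTy.monotone_arr_iff.2 hf.2
    have key : ∀ n : ℕ, S (Nat.rec (motive := fun _ => σ.Interp) x (fun k r => f k r) n)
        (Nat.rec (motive := fun _ => s.Interp) a (fun k r => s.join r (b k r)) n, ()) := by
      intro n
      induction n with
      | zero => exact hx
      | succ n ih =>
        have hr := (hm ih).1
        have hbr := (hb.app (Nat.le_refl n)).app hr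
        exact ht ((hf.1 n n (Nat.le_refl n)).1 _ _ ih)
          ⟨(WTy.le_join_right _ _).maj hbr (hr.join hbr), trivial⟩
    -- `key` compares both recursions after the same `n` steps; monotonicity of the majorant in its
    -- number argument carries the bound from `n` to `N`.
    have hmono := (h.monotone n N hn).1 a a (hm hx).1
    exact ht (key n) ⟨(hmono.1 b b hb).1, trivial⟩

theorem Const.majorizable : ∀ {σ : Ty} (c : Const σ), σ.Majorizable c.eval
  | _, .pi ρ σ => majorizable_pi ρ σ
  | _, .sig ρ σ γ => majorizable_sig ρ σ γ
  | _, .zero => ⟨(WConst.zero.eval, ()), ⟨.const WConst.monotone_zero, trivial⟩, Nat.le_refl 0⟩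
  | _, .succ => ⟨(WConst.succ.eval, ()), ⟨.const WConst.monotone_succ, trivial⟩,
      arrMaj_of_monotone WConst.monotone_succ fun _ _ h => Nat.succ_le_succ h⟩
  | _, .recur σ => majorizable_recur σ
  | _, .bool0 => ⟨(), trivial, trivial⟩
  | _, .bool1 => ⟨(), trivial, trivial⟩
  | _, .cond σ => majorizable_cond σ

/-- If both types are unbounded, the majorants are applied to each other. If only the argument type
is bounded, the majorant of `f` already bounds every value. If the result type is bounded, its
relation always holds. -/
theorem arrMaj_app {X Y : Type} : ∀ {s t : Option WTy} (Q : X → WTuple s.toList → Prop)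
    (R : Y → WTuple t.toList → Prop), (t = none → ∀ y a, R y a) →
    ∃ F : WTuple (s.toList ++ (arrDagger s t).toList) → WTuple t.toList, Witnessings F ∧
      ∀ x f u, Q x (Tuple.left u) → arrMaj s t Q R f (Tuple.right u) → R (f x) (F u)
  | some s, some t, _, _, _ => ⟨fun u => (u.2.1 u.1, ()),
      ⟨Witnessing.app (Γ := [s, s ⇾ t]) (.weaken .head) .head, trivial⟩,
      fun x _ _ hx hf => hf.1 x _ hx⟩
  | none, some t, _, _, _ => ⟨fun u => u, Witnessings.id (m := [t]), fun x _ _ _ hf => hf.1 x⟩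
  | some _, none, _, _, h => ⟨fun _ => (), trivial, fun _ _ _ _ _ => h rfl _ _⟩
  | none, none, _, _, h => ⟨fun _ => (), trivial, fun _ _ _ _ _ => h rfl _ _⟩

theorem Ty.maj_of_dagger_eq_none : ∀ {σ : Ty}, σ.dagger = none →
    ∀ (x : σ.Interp) (a : WTuple σ.dagger.toList), σ.Maj x a
  | .bool, _, _, _ => trivial
  | .arr σ τ, h, f, g => by
    simp only [Ty.Maj, Ty.dagger] at h g ⊢
    generalize Ty.Maj σ = Q at *
    generalize Ty.Maj τ = R at *
    generalize σ.dagger = s at *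
    generalize τ.dagger = t at *
    match s, t with
    | some _, none | none, none => trivial

theorem interpretable_appSentence (σ τ : Ty) :
    (Imb.uInter (BaseInterp.appSentence σ τ)).Interpretable := by
  obtain ⟨F, hF, h⟩ := arrMaj_app σ.Maj τ.Maj Ty.maj_of_dagger_eq_none
  refine .all (.all (InfoRel.Interpretable.imp_intro (F := F) (G := fun _ _ => ()) hF trivial ?_))
  intro e u _ _ _ hu
  have hu' := hu () trivial
  exact h _ _ u hu'.1 hu'.2

theorem Imb.isTypeInformative : Imb.IsTypeInformative where
  witness := Imb.isWitnessStructure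
  const c := by
    obtain ⟨a, ha, h⟩ := c.majorizable
    exact uInterpretable_iff.2 ⟨a, ha, fun _ _ _ => h⟩
  app σ τ := uInterpretable_iff.2 (interpretable_appSentence σ τ)

end FunInt

theorem mainTheorem4 : FunInt.Imb.IsSoundTypeInformative where
  typeInformative := FunInt.Imb.isTypeInformative
  axioms _ h := FunInt.interpretable_guardedClosure (FunInt.interpretable_of_ax h)
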